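/- **Setting.** Let $k<0$ be an integer, $N\ge 1$, and $\chi$ a Dirichlet character modulo $N$ with $\chi(-1)=(-1)^k$. Write $\tau=u+iv\in\mathbb H$, $q=e^{2\pi i\tau}$. Let $H_k^\#(N,\chi)$ be the space of real-smooth $f:\mathbb H\to\mathbb C$ with $(c\tau+d)^{-k}f(\gamma\tau)=\chi(d)f(\tau)$ for all $\gamma=\begin{pmatrix}a&b\\c&d\end{pmatrix}\in\Gamma_0(N)$, with $\Delta_kf=0$, where $\Delta_k=-v^2(\partial_u^2+\partial_v^2)+ikv(\partial_u+i\partial_v)$, and of at most polynomial growth at all cusps (for every $\gamma\in SL_2(\mathbb Z)$ there is $A$ with $f|_k\gamma=O(v^A)$ as $v\to\infty$, uniformly in $u$). Let $f\in H_k^\#(N,\chi)$ and $g=f|_k\omega(N)$, i.e. $g(\tau)=N^{k/2}(N\tau)^{-k}f(-1/(N\tau))$, have the Fourier expansions $$f(\tau)=\sum_{n\ge0}c_f^+(n)q^n+c_f^-(0)v^{1-k}+\sum_{n<0}c_f^-(n)\Gamma(1-k,-4\pi nv)q^n,$$ and similarly for $g$ with coefficients $c_g^\pm(n)$, all coefficients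 being $O(|n|^\alpha)$ for some $\alpha\ge0$; here $\Gamma(\nu,x)=\int_x^\infty e^{-t}t^{\nu-1}dt$. Put $W_\nu(s)=\int_0^\infty\Gamma(\nu,2x)e^xx^{s-1}dx$. For a Dirichlet character $\psi$ modulo $m$ let $$L^{\pm}(f,s,\psi)=\sum_{n\ge1}\psi(\pm n)c_f^\pm(\pm n)n^{-s},$$ and, for $\mathrm{Re}\, s>\alpha+1$, $$\Lambda_N(f,s,\psi)=\Big(\tfrac{m\sqrt N}{2\pi}\Big)^s\big[\Gamma(s)L^+(f,s,\psi)+W_{1-k}(s)L^-(f,s,\psi)\big],$$ $$\Xi_N(f,s,\psi)=\Big(\tfrac{m\sqrt N}{2\pi}\Big)^s\big[\Gamma(s+1)L^+(f,s,\psi)-W_{1-k}(s+1)L^-(f,s,\psi)\big],$$ $$\Omega_N(f,s,\psi)=-2\,\Xi_N(f,s,\psi)+k\Lambda_N(f,s,\psi).$$ Write $\Lambda_N(f,s)$, $\Omega_N(f,s)$ for these functions with $m=1$ and $\psi$ trivial, and use the same notation for $g$. Let $\tau(\psi)=\sum_{a \bmod m}\psi(a)e^{2\pi ia/m}$. **Theorem.**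 (A) Let $\psi$ be a primitive Dirichlet character of conductor $m>1$ with $\gcd(m,N)=1$. Then $\Lambda_N(f,s,\psi)$, $\Lambda_N(g,s,\bar\psi)$, $\Omega_N(f,s,\psi)$, $\Omega_N(g,s,\bar\psi)$ continue to entire functions that are bounded in vertical strips, and $$\Lambda_N(f,s,\psi)=i^kC_\psi\Lambda_N(g,k-s,\bar\psi),\qquad \Omega_N(f,s,\psi)=-i^kC_\psi\Omega_N(g,k-s,\bar\psi),$$ where $C_\psi=\chi(m)\psi(-N)\tau(\psi)/\tau(\bar\psi)=\chi(m)\psi(N)\tau(\psi)^2/m$. (B) Moreover, the direct part of the converse theorem holds, that is: (a) $\Lambda_N(f,s)$, $\Lambda_N(g,s)$, $\Omega_N(f,s)$, $\Omega_N(g,s)$ continue meromorphically to $\mathbb C$, with $$\Lambda_N(f,s)=i^k\Lambda_N(g,k-s),\qquad \Omega_N(f,s)=-i^k\Omega_N(g,k-s),$$ and the following functions are entire and bounded in vertical strips: $$\Lambda_N(f,s)+\frac{c_f^+(0)}{s}+\frac{c_g^+(0)i^k}{k-s}+\frac{c_f^-(0)}{N^{(1-k)/2}}\frac1{s-k+1}+\frac{c_g^-(0)i^k}{N^{(1-k)/2}}\frac1{1-s},$$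 $$\Lambda_N(g,s)+\frac{c_g^+(0)}{s}+\frac{c_f^+(0)i^{-k}}{k-s}+\frac{c_g^-(0)}{N^{(1-k)/2}}\frac1{s-k+1}+\frac{c_f^-(0)i^{-k}}{N^{(1-k)/2}}\frac1{1-s},$$ $$\Omega_N(f,s)+k\Big(\frac{c_f^+(0)}{s}-\frac{c_g^+(0)i^k}{k-s}+\frac{c_f^-(0)}{N^{(1-k)/2}}\frac1{s-k+1}-\frac{c_g^-(0)i^k}{N^{(1-k)/2}}\frac1{1-s}\Big),$$ $$\Omega_N(g,s)+k\Big(\frac{c_g^+(0)}{s}-\frac{c_f^+(0)i^{-k}}{k-s}+\frac{c_g^-(0)}{N^{(1-k)/2}}\frac1{s-k+1}-\frac{c_f^-(0)i^{-k}}{N^{(1-k)/2}}\frac1{1-s}\Big).$$ (b) If $\mathcal P$ is a set of integers coprime to $N$, each an odd prime or $4$, that meets every arithmetic progression $a+b\mathbb Z$ with $b\ne0$ and $\gcd(a,b)=1$, then for every primitive $\psi$ with conductor $m\in\mathcal P$ the functions $\Lambda_N(f,s,\psi)$, $\Lambda_N(g,s,\psi)$, $\Omega_N(f,s,\psi)$,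 $\Omega_N(g,s,\psi)$ continue to entire functions bounded in vertical strips, and the functional equations of (A) hold. -/

import Mathlib

open scoped MatrixGroups ModularForm ContDiff

noncomputable section

namespace HarmonicMaass

open Complex
open UpperHalfPlane hiding I

/-! ### Harmonic Maass forms of polynomial growth -/

/-- The partial derivative `∂F/∂u` of a function of `τ = u + i v`. -/
def partialU (F : ℂ → ℂ) (z : ℂ) : ℂ := fderiv ℝ F z 1

/-- The partial derivative `∂F/∂v` of a function of `τ = u + i v`. -/
def partialV (F : ℂ → ℂ) (z : ℂ) : ℂ := fderiv ℝ F z I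

/-- The weight `k` hyperbolic Laplacian
`Δ_k = -v² (∂²/∂u² + ∂²/∂v²) + i k v (∂/∂u + i ∂/∂v)` on functions on the upper half-plane. -/
def laplacian (k : ℤ) (f : ℍ → ℂ) (τ : ℍ) : ℂ :=
  let F : ℂ → ℂ := fun z => f (ofComplex z);
  (-(τ.im : ℂ) ^ 2) * (partialU (partialU F) τ + partialV (partialV F) τ)
    + I * (k : ℂ) * (τ.im : ℂ) * (partialU F τ + I * partialV F τ)

/-- `f ∈ H_k^#(N, χ)`: `f` is smooth in the real sense, satisfies `f|_k γ = χ(d) f` for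
`γ ∈ Γ₀(N)` with lower right entry `d`, is annihilated by `Δ_k`, and has at most polynomial growth
at every cusp: for each `γ ∈ SL₂(ℤ)`, `f|_k γ (u + i v) = O(v^A)` for some `A`, as `v → ∞`,
uniformly in `u`. -/
structure IsHarmonicMaassPoly (k : ℤ) (N : ℕ) (χ : DirichletCharacter ℂ N) (f : ℍ → ℂ) :
    Prop where
  smooth : ContDiffOn ℝ ∞ (fun z : ℂ => f (ofComplex z)) {z : ℂ | 0 < z.im}
  slash_eq : ∀ γ : SL(2, ℤ), γ ∈ CongruenceSubgroup.Gamma0 N →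
    ∀ τ : ℍ, (f ∣[k] γ) τ = χ ((γ 1 1 : ℤ) : ZMod N) * f τ
  harmonic : ∀ τ : ℍ, laplacian k f τ = 0
  growth : ∀ γ : SL(2, ℤ), ∃ A : ℝ, (f ∣[k] γ) =O[atImInfty] fun τ : ℍ => τ.im ^ A

/-- The Fricke involution `f|_k ω(N) (τ) = N^{k/2} (N τ)^{-k} f(-1/(N τ))`. -/
def fricke (k : ℤ) (N : ℕ) (f : ℍ → ℂ) (τ : ℍ) : ℂ :=
  (((N : ℝ) ^ ((k : ℝ) / 2) : ℝ) : ℂ) * ((N : ℂ) * (τ : ℂ)) ^ (-k)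
    * f (ofComplex (-1 / ((N : ℂ) * (τ : ℂ))))

/-! ### Fourier series -/

/-- The upper incomplete gamma function `Γ(ν, x) = ∫_x^∞ e^{-t} t^{ν-1} dt` for real `ν`, `x`. -/
def incGamma (ν x : ℝ) : ℝ := ∫ t in Set.Ioi x, Real.exp (-t) * t ^ (ν - 1)

/-- The coefficients of a Fourier series: `plus n = c⁺(n)` and `minus n = c⁻(-n)` for `n ≥ 0`. -/
structure FourierCoeffs where
  plus : ℕ → ℂ
  minus : ℕ → ℂ

/-- `f(τ) = ∑_{n≥0} c⁺(n) qⁿ + c⁻(0) v^{1-k} + ∑_{n<0} c⁻(n) Γ(1-k, -4πnv) qⁿ` on the upper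
half-plane, with `τ = u + i v` and `q = e^{2πiτ}`; the last sum is indexed by `-n-1`, `n ≥ 0`. -/
def HasFourierSeries (k : ℤ) (f : ℍ → ℂ) (c : FourierCoeffs) : Prop :=
  ∀ τ : ℍ, f τ =
    (∑' n : ℕ, c.plus n * exp (2 * Real.pi * I * (n : ℂ) * (τ : ℂ)))
    + c.minus 0 * ((τ.im ^ (1 - k) : ℝ) : ℂ)
    + ∑' n : ℕ, c.minus (n + 1)
        * ((incGamma (1 - k) (4 * Real.pi * ((n : ℝ) + 1) * τ.im) : ℝ) : ℂ)
        * exp (-(2 * Real.pi * I * ((n : ℂ) + 1) * (τ : ℂ)))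

/-- The coefficients are `O(|n|^α)`. -/
def FourierCoeffs.IsBigO (c : FourierCoeffs) (α : ℝ) : Prop :=
  ∃ C : ℝ, ∀ n : ℕ, 1 ≤ n → ‖c.plus n‖ ≤ C * (n : ℝ) ^ α ∧ ‖c.minus n‖ ≤ C * (n : ℝ) ^ α

/-- The coefficients `ψ(n) c^±(n)`, `n ∈ ℤ`, of the twist by `ψ`; so the coefficient with
index `-n` is multiplied by `ψ(-n)`. -/
def FourierCoeffs.twist {m : ℕ} (c : FourierCoeffs) (ψ : DirichletCharacter ℂ m) :
    FourierCoeffs where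
  plus n := ψ (n : ZMod m) * c.plus n
  minus n := ψ (-(n : ZMod m)) * c.minus n

/-! ### Completed Dirichlet series -/

/-- `W_ν(s) = ∫_0^∞ Γ(ν, 2x) e^x x^s dx/x`. -/
def W (ν : ℝ) (s : ℂ) : ℂ := mellin (fun x : ℝ => ((incGamma ν (2 * x) * Real.exp x : ℝ) : ℂ)) s

/-- `L⁺(s) = ∑_{n≥1} c⁺(n) n^{-s}`. -/
def LPlus (c : FourierCoeffs) (s : ℂ) : ℂ := LSeries c.plus s

/-- `L⁻(s) = ∑_{n≥1} c⁻(-n) n^{-s}`. -/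
def LMinus (c : FourierCoeffs) (s : ℂ) : ℂ := LSeries c.minus s

/-- `(R/2π)^s [Γ(s) L⁺(s) + W_{1-k}(s) L⁻(s)]`. -/
def scaledLambda (k : ℤ) (R : ℝ) (c : FourierCoeffs) (s : ℂ) : ℂ :=
  ((R / (2 * Real.pi) : ℝ) : ℂ) ^ s * (Gamma s * LPlus c s + W (1 - k) s * LMinus c s)

/-- `(R/2π)^s [Γ(s+1) L⁺(s) - W_{1-k}(s+1) L⁻(s)]`. -/
def scaledXi (k : ℤ) (R : ℝ) (c : FourierCoeffs) (s : ℂ) : ℂ :=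
  ((R / (2 * Real.pi) : ℝ) : ℂ) ^ s
    * (Gamma (s + 1) * LPlus c s - W (1 - k) (s + 1) * LMinus c s)

/-- `-2 Ξ + k Λ`. -/
def scaledOmega (k : ℤ) (R : ℝ) (c : FourierCoeffs) (s : ℂ) : ℂ :=
  -2 * scaledXi k R c s + (k : ℂ) * scaledLambda k R c s

/-- `Λ_N(f, s)`, where `c` are the Fourier coefficients of `f`. -/
def Lambda (k : ℤ) (N : ℕ) (c : FourierCoeffs) (s : ℂ) : ℂ := scaledLambda k (√(N : ℝ)) c s

/-- `Ω_N(f, s)`. -/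
def Omega (k : ℤ) (N : ℕ) (c : FourierCoeffs) (s : ℂ) : ℂ := scaledOmega k (√(N : ℝ)) c s

/-- `Λ_N(f, s, ψ)` for `ψ` modulo `m`. -/
def twistedLambda (k : ℤ) (N : ℕ) (c : FourierCoeffs) {m : ℕ} (ψ : DirichletCharacter ℂ m)
    (s : ℂ) : ℂ :=
  scaledLambda k ((m : ℝ) * √(N : ℝ)) (c.twist ψ) s

/-- `Ω_N(f, s, ψ)` for `ψ` modulo `m`. -/
def twistedOmega (k : ℤ) (N : ℕ) (c : FourierCoeffs) {m : ℕ} (ψ : DirichletCharacter ℂ m)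
    (s : ℂ) : ℂ :=
  scaledOmega k ((m : ℝ) * √(N : ℝ)) (c.twist ψ) s

/-! ### Analytic properties -/

/-- `F` is bounded on every vertical strip `a ≤ Re s ≤ b`. -/
def BoundedInVerticalStrips (F : ℂ → ℂ) : Prop :=
  ∀ a b : ℝ, ∃ C : ℝ, ∀ s : ℂ, a ≤ s.re → s.re ≤ b → ‖F s‖ ≤ C

/-- `F` extends the function `D`, given on the half-plane `Re s > σ`. -/
def Extends (σ : ℝ) (D F : ℂ → ℂ) : Prop := ∀ s : ℂ, σ < s.re → F s = D s

/-- `F` is an entire continuation, bounded in vertical strips, of `D` given on `Re s > σ`. -/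
def IsEntireContinuation (σ : ℝ) (D F : ℂ → ℂ) : Prop :=
  Differentiable ℂ F ∧ BoundedInVerticalStrips F ∧ Extends σ D F

/-- The function `F`, defined away from the finite set `S`, coincides there with an entire function
that is bounded in vertical strips. -/
def IsEntireBoundedOff (S : Set ℂ) (F : ℂ → ℂ) : Prop :=
  ∃ E : ℂ → ℂ, Differentiable ℂ E ∧ BoundedInVerticalStrips E ∧ ∀ s : ℂ, s ∉ S → E s = F s

/-- `C_ψ = χ(m) ψ(-N) τ(ψ) / τ(ψ̄)`, with `ψ̄ = ψ⁻¹` and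
`τ(ψ) = ∑_{a mod m} ψ(a) e^{2πia/m}`. -/
def CPsi {N m : ℕ} [NeZero m] (χ : DirichletCharacter ℂ N) (ψ : DirichletCharacter ℂ m) : ℂ :=
  χ (m : ZMod N) * ψ (-(N : ZMod m))
    * gaussSum ψ (ZMod.stdAddChar (N := m)) / gaussSum ψ⁻¹ (ZMod.stdAddChar (N := m))

/-- The twisted series `Λ_N(f,s,ψ)`, `Λ_N(g,s,ψ̄)`, `Ω_N(f,s,ψ)`, `Ω_N(g,s,ψ̄)` continue to entire
functions, bounded in vertical strips, with
`Λ_N(f,s,ψ) = i^k C_ψ Λ_N(g,k-s,ψ̄)` and `Ω_N(f,s,ψ) = -i^k C_ψ Ω_N(g,k-s,ψ̄)`. -/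
def TwistedFunctionalEquations (k : ℤ) (N : ℕ) (χ : DirichletCharacter ℂ N) (σ : ℝ)
    (c d : FourierCoeffs) {m : ℕ} [NeZero m] (ψ : DirichletCharacter ℂ m) : Prop :=
  ∃ Λf Λg Ωf Ωg : ℂ → ℂ,
    IsEntireContinuation σ (twistedLambda k N c ψ) Λf ∧
    IsEntireContinuation σ (twistedLambda k N d ψ⁻¹) Λg ∧
    IsEntireContinuation σ (twistedOmega k N c ψ) Ωf ∧
    IsEntireContinuation σ (twistedOmega k N d ψ⁻¹) Ωg ∧
    (∀ s : ℂ, Λf s = I ^ k * CPsi χ ψ * Λg (k - s)) ∧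
    (∀ s : ℂ, Ωf s = -I ^ k * CPsi χ ψ * Ωg (k - s))

/-- The points where the untwisted completed series may have poles. -/
def poleSet (k : ℤ) : Set ℂ := {0, (k : ℂ), (k : ℂ) - 1, 1}

/-- The untwisted condition: meromorphic continuation of `Λ_N(f,s)`, `Λ_N(g,s)`, `Ω_N(f,s)`,
`Ω_N(g,s)` to the plane, their functional equations, and the entire functions, bounded in vertical
strips, obtained by adding the explicit polar terms. -/
def UntwistedCondition (k : ℤ) (N : ℕ) (σ : ℝ) (c d : FourierCoeffs) : Prop :=
  let r : ℂ := (((N : ℝ) ^ ((1 - (k : ℝ)) / 2) : ℝ) : ℂ)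
  ∃ Λf Λg Ωf Ωg : ℂ → ℂ,
    (MeromorphicOn Λf Set.univ ∧ Extends σ (Lambda k N c) Λf) ∧
    (MeromorphicOn Λg Set.univ ∧ Extends σ (Lambda k N d) Λg) ∧
    (MeromorphicOn Ωf Set.univ ∧ Extends σ (Omega k N c) Ωf) ∧
    (MeromorphicOn Ωg Set.univ ∧ Extends σ (Omega k N d) Ωg) ∧
    (∀ s : ℂ, s ∉ poleSet k → Λf s = I ^ k * Λg (k - s)) ∧
    (∀ s : ℂ, s ∉ poleSet k → Ωf s = -I ^ k * Ωg (k - s)) ∧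
    IsEntireBoundedOff (poleSet k) (fun s => Λf s
      + c.plus 0 / s + d.plus 0 * I ^ k / (k - s)
      + c.minus 0 / r * (1 / (s - k + 1)) + d.minus 0 * I ^ k / r * (1 / (1 - s))) ∧
    IsEntireBoundedOff (poleSet k) (fun s => Λg s
      + d.plus 0 / s + c.plus 0 * I ^ (-k) / (k - s)
      + d.minus 0 / r * (1 / (s - k + 1)) + c.minus 0 * I ^ (-k) / r * (1 / (1 - s))) ∧
    IsEntireBoundedOff (poleSet k) (fun s => Ωf s
      + k * (c.plus 0 / s - d.plus 0 * I ^ k / (k - s)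
      + c.minus 0 / r * (1 / (s - k + 1)) - d.minus 0 * I ^ k / r * (1 / (1 - s)))) ∧
    IsEntireBoundedOff (poleSet k) (fun s => Ωg s
      + k * (d.plus 0 / s - c.plus 0 * I ^ (-k) / (k - s)
      + d.minus 0 / r * (1 / (s - k + 1)) - c.minus 0 * I ^ (-k) / r * (1 / (1 - s))))

/-- A set of odd primes, or `4`, coprime to `N`, that meets every arithmetic progression
`a + n b` (`n ∈ ℤ`) with `a`, `b` coprime. -/
def IsAdmissibleModuli (N : ℕ) (P : Set ℕ) : Prop :=
  (∀ m ∈ P, ((m.Prime ∧ Odd m) ∨ m = 4) ∧ m.Coprime N) ∧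
  ∀ a b : ℤ, b ≠ 0 → IsCoprime a b → ∃ n : ℤ, ∃ m ∈ P, (m : ℤ) = a + n * b

/-- The twisted condition for all primitive characters with conductor in `P`. -/
def TwistedCondition (k : ℤ) (N : ℕ) (χ : DirichletCharacter ℂ N) (σ : ℝ)
    (c d : FourierCoeffs) (P : Set ℕ) : Prop :=
  ∀ (m : ℕ) [NeZero m], m ∈ P → ∀ ψ : DirichletCharacter ℂ m, ψ.IsPrimitive →
    TwistedFunctionalEquations k N χ σ c d ψ ∧
    (∃ F : ℂ → ℂ, IsEntireContinuation σ (twistedLambda k N d ψ) F) ∧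
    (∃ F : ℂ → ℂ, IsEntireContinuation σ (twistedOmega k N d ψ) F)

end HarmonicMaass

end

noncomputable section

namespace HarmonicMaass

open Complex Set Filter Topology MeasureTheory

/-! ### Mellin transforms of rapidly decaying functions -/

/-! The argument is Hecke's, in Weil's twisted form, with one extra ingredient for non-holomorphic
forms. On `τ = iy/R` the nonconstant part of the Fourier series is a sum of dilates of `e^{-x}` and
`Γ(1-k,2x)e^x`, so its Mellin transform is the completed series `Λ` (`mellin_cuspPart`). The Fricke
relation `f(-1/(R²z)) = C (Rz)^k g(z)` links the values at `1/y` and `y`. Splitting the Mellin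
integral at `y = 1` leaves an entire function, symmetric under `s ↦ k - s`, and elementary integrals
of the constant terms over `(0,1]`, which are the poles (`mellin_eq_entirePart`).

The series `Ω` comes from the derivative across the imaginary axis. The Mellin transform of `D_f =
-iv ∂f/∂u` is `Ξ` (`mellin_derivPart`), and differentiating the Fricke relation in `u` at `u = 0`
gives `D_f(1/y) = i^k C y^k (-D_g(y) + k g(iy/R))` (`derivPart_inv`). The combination `-2D + k f`
absorbs the inhomogeneous term and transforms by `-i^k C y^k`, so Hecke's argument applies again
with the opposite sign.

For a primitive `ψ` modulo `m`, `τ(ψ̄) f_ψ(z) = ∑ ψ̄(a) f(z + a/m)`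
(`gaussSum_mul_fourierFun_twist`). If `aNb ≡ -1` modulo `m`, a matrix of `Γ₀(N)` with lower right
entry `m` matches the translate of `f` by `a/m` with the translate of `g` by `b/m`. The factor
`χ(m)` and the identity `ψ̄(a) = ψ(-N)ψ(b)` assemble to `C_ψ` (`fourierFun_twist_neg_one_div`).
Since `m > 1`, `ψ(0) = 0` and the twisted series have no poles. -/

/-- `F` is continuous on `(0, ∞)` and `O(y^{-β})` there for every `β > σ`. -/
def RapidDecay (σ : ℝ) (F : ℝ → ℂ) : Prop :=
  ContinuousOn F (Ioi 0) ∧ ∀ β : ℝ, σ < β → ∃ C : ℝ, ∀ y : ℝ, 0 < y → ‖F y‖ ≤ C * y ^ (-β)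

namespace RapidDecay

variable {σ : ℝ} {F G : ℝ → ℂ}

lemma add (hF : RapidDecay σ F) (hG : RapidDecay σ G) : RapidDecay σ (fun y => F y + G y) := by
  refine ⟨hF.1.add hG.1, fun β hβ => ?_⟩
  obtain ⟨C, hC⟩ := hF.2 β hβ
  obtain ⟨D, hD⟩ := hG.2 β hβ
  refine ⟨C + D, fun y hy => (norm_add_le _ _).trans ?_⟩
  rw [add_mul]
  exact add_le_add (hC y hy) (hD y hy)

lemma const_mul (hF : RapidDecay σ F) (a : ℂ) : RapidDecay σ (fun y => a * F y) := by
  refine ⟨continuousOn_const.mul hF.1, fun β hβ => ?_⟩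
  obtain ⟨C, hC⟩ := hF.2 β hβ
  refine ⟨‖a‖ * C, fun y hy => ?_⟩
  rw [norm_mul, mul_assoc]
  exact mul_le_mul_of_nonneg_left (hC y hy) (norm_nonneg _)

lemma locallyIntegrableOn (hF : RapidDecay σ F) : LocallyIntegrableOn F (Ioi 0) :=
  hF.1.locallyIntegrableOn measurableSet_Ioi

lemma isBigO_atTop (hF : RapidDecay σ F) {β : ℝ} (hβ : σ < β) : F =O[atTop] (· ^ (-β)) := by
  obtain ⟨C, hC⟩ := hF.2 β hβ
  refine Asymptotics.IsBigO.of_bound C ?_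
  filter_upwards [eventually_gt_atTop 0] with y hy
  rw [Real.norm_of_nonneg (by positivity)]
  exact hC y hy

lemma isBigO_zero (hF : RapidDecay σ F) {β : ℝ} (hβ : σ < β) : F =O[𝓝[>] 0] (· ^ (-β)) := by
  obtain ⟨C, hC⟩ := hF.2 β hβ
  refine Asymptotics.IsBigO.of_bound C ?_
  filter_upwards [self_mem_nhdsWithin] with y (hy : 0 < y)
  rw [Real.norm_of_nonneg (by positivity)]
  exact hC y hy

lemma mellinConvergent (hF : RapidDecay σ F) {s : ℂ} (hs : σ < s.re) : MellinConvergent F s :=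
  mellinConvergent_of_isBigO_rpow hF.locallyIntegrableOn
    (hF.isBigO_atTop (hs.trans (lt_add_one s.re))) (lt_add_one _)
    (hF.isBigO_zero (β := (σ + s.re) / 2) (by linarith)) (by linarith)

/-- Cutting off at `1` removes the only obstruction to convergence, the behaviour at `0`; hence the
truncated Mellin transform is entire. -/
lemma indicator_isBigO_zero (F : ℝ → ℂ) (b : ℝ) :
    (indicator (Ioi 1) F) =O[𝓝[>] 0] ((· ^ (-b)) : ℝ → ℝ) := by
  refine Asymptotics.IsBigO.of_bound 0 ?_
  filter_upwards [nhdsWithin_le_nhds (gt_mem_nhds (zero_lt_one' ℝ))] with y hy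
  simp [indicator_of_notMem, not_lt.mpr hy.le]

lemma indicator_isBigO_atTop (hF : RapidDecay σ F) (b : ℝ) :
    (indicator (Ioi 1) F) =O[atTop] ((· ^ (-b)) : ℝ → ℝ) := by
  obtain ⟨C, hC⟩ := hF.2 (max b (σ + 1)) (by simp)
  refine Asymptotics.IsBigO.of_bound |C| ?_
  filter_upwards [eventually_gt_atTop 1] with y hy
  have hy0 : 0 < y := by linarith
  rw [Real.norm_of_nonneg (by positivity), indicator_of_mem (by exact hy)]
  refine (hC y hy0).trans (mul_le_mul (le_abs_self C) ?_ (by positivity) (by positivity))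
  exact Real.rpow_le_rpow_of_exponent_le hy.le (by simp)

lemma indicator_locallyIntegrableOn (hF : RapidDecay σ F) :
    LocallyIntegrableOn (indicator (Ioi 1) F) (Ioi 0) := by
  intro x hx
  obtain ⟨t, ht, hi⟩ := hF.locallyIntegrableOn x hx
  exact ⟨t, ht, hi.indicator measurableSet_Ioi⟩

lemma indicator_mellinConvergent (hF : RapidDecay σ F) (s : ℂ) :
    MellinConvergent (indicator (Ioi 1) F) s :=
  mellinConvergent_of_isBigO_rpow hF.indicator_locallyIntegrableOn
    (hF.indicator_isBigO_atTop (s.re + 1)) (lt_add_one _)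
    (indicator_isBigO_zero F (s.re - 1)) (sub_one_lt _)

lemma differentiable_mellin_indicator (hF : RapidDecay σ F) :
    Differentiable ℂ (mellin (indicator (Ioi 1) F)) := fun s =>
  mellin_differentiableAt_of_isBigO_rpow hF.indicator_locallyIntegrableOn
    (hF.indicator_isBigO_atTop (s.re + 1)) (lt_add_one _)
    (indicator_isBigO_zero F (s.re - 1)) (sub_one_lt _)

lemma boundedInVerticalStrips_mellin_indicator (hF : RapidDecay σ F) :
    BoundedInVerticalStrips (mellin (indicator (Ioi 1) F)) := by
  intro a b
  -- For `t > 1` the size of `t^{s-1}` increases with `Re s`, so the right edge `b` of the strip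
  -- dominates and the left edge plays no role.
  refine ⟨∫ t in Ioi (0 : ℝ), ‖((t : ℂ) ^ ((b : ℂ) - 1) • indicator (Ioi 1) F t)‖, fun s _ hb => ?_⟩
  refine norm_integral_le_of_norm_le (hF.indicator_mellinConvergent b).norm ?_
  filter_upwards [ae_restrict_mem measurableSet_Ioi] with t (ht : 0 < t)
  by_cases h1 : 1 < t
  · rw [norm_smul, norm_smul, norm_cpow_eq_rpow_re_of_pos ht, norm_cpow_eq_rpow_re_of_pos ht]
    refine mul_le_mul_of_nonneg_right
      (Real.rpow_le_rpow_of_exponent_le h1.le ?_) (norm_nonneg _)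
    simpa using hb
  · simp [indicator_of_notMem, h1]

end RapidDecay

/-! ### Hecke's splitting of the Mellin integral at `1`. -/

lemma BoundedInVerticalStrips.add {F G : ℂ → ℂ} (hF : BoundedInVerticalStrips F)
    (hG : BoundedInVerticalStrips G) : BoundedInVerticalStrips (fun s => F s + G s) := by
  intro a b
  obtain ⟨C, hC⟩ := hF a b
  obtain ⟨D, hD⟩ := hG a b
  exact ⟨C + D, fun s h1 h2 => (norm_add_le _ _).trans (add_le_add (hC s h1 h2) (hD s h1 h2))⟩

lemma BoundedInVerticalStrips.const_mul {F : ℂ → ℂ} (hF : BoundedInVerticalStrips F) (a : ℂ) :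
    BoundedInVerticalStrips (fun s => a * F s) := by
  intro x y
  obtain ⟨C, hC⟩ := hF x y
  exact ⟨‖a‖ * C, fun s h1 h2 => by
    rw [norm_mul]; exact mul_le_mul_of_nonneg_left (hC s h1 h2) (norm_nonneg _)⟩

lemma BoundedInVerticalStrips.comp_sub {F : ℂ → ℂ} (hF : BoundedInVerticalStrips F) (k : ℤ) :
    BoundedInVerticalStrips (fun s => F (k - s)) := by
  intro a b
  obtain ⟨C, hC⟩ := hF (k - b) (k - a)
  refine ⟨C, fun s h1 h2 => hC _ ?_ ?_⟩ <;> simp <;> linarith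

/-- The entire part of the Mellin transform of `F`, when `F(1/y)` equals `ε y^k G(y)` up to polar
terms. -/
def entirePart (k : ℤ) (ε : ℂ) (F G : ℝ → ℂ) (s : ℂ) : ℂ :=
  mellin (indicator (Ioi 1) F) s + ε * mellin (indicator (Ioi 1) G) (k - s)

section

variable {σ : ℝ} {F G : ℝ → ℂ} {k : ℤ} {ε : ℂ}

lemma differentiable_entirePart (hF : RapidDecay σ F) (hG : RapidDecay σ G) :
    Differentiable ℂ (entirePart k ε F G) :=
  hF.differentiable_mellin_indicator.add
    ((hG.differentiable_mellin_indicator.comp (differentiable_id.const_sub _)).const_mul ε)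

lemma boundedInVerticalStrips_entirePart (hF : RapidDecay σ F) (hG : RapidDecay σ G) :
    BoundedInVerticalStrips (entirePart k ε F G) :=
  hF.boundedInVerticalStrips_mellin_indicator.add
    ((hG.boundedInVerticalStrips_mellin_indicator.comp_sub k).const_mul ε)

lemma entirePart_functional_equation (hε : ε ≠ 0) (s : ℂ) :
    entirePart k ε F G s = ε * entirePart k ε⁻¹ G F (k - s) := by
  simp only [entirePart, sub_sub_cancel]
  rw [mul_add, ← mul_assoc, mul_inv_cancel₀ hε]
  ring

lemma mellin_eq_indicator_add (hF : RapidDecay σ F) {s : ℂ} (hs : σ < s.re) :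
    mellin F s = mellin (indicator (Ioi 1) F) s + mellin (indicator (Ioc 0 1) F) s := by
  have h1 := hF.indicator_mellinConvergent s
  have h2 : MellinConvergent (indicator (Ioc 0 1) F) s := by
    have := (hF.mellinConvergent hs).indicator (measurableSet_Ioc (a := (0:ℝ)) (b := 1))
    refine this.congr (Eventually.of_forall fun t => ?_)
    simp only [indicator]
    split_ifs <;> simp
  rw [← (hasMellin_add h1 h2).2]
  refine setIntegral_congr_fun measurableSet_Ioi fun t (ht : 0 < t) => ?_
  by_cases h : 1 < t
  · simp [indicator, h, not_le.mpr h]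
  · simp [indicator, h, not_lt.mp h, ht]

lemma hasMellin_indicator_comp_inv (hG : RapidDecay σ G) (k : ℤ) (s : ℂ) :
    HasMellin (indicator (Ioc 0 1) (fun t : ℝ => (t : ℂ) ^ (-k : ℂ) * G t⁻¹)) s
      (mellin (indicator (Ioi 1) G) (k - s)) := by
  have key : (fun t : ℝ => (t : ℂ) ^ (s - 1) •
        ((t : ℂ) ^ (-k : ℂ) • (fun t => indicator (Ioi 1) G t⁻¹) t))
      =ᵐ[volume.restrict (Ioi 0)] fun t : ℝ => (t : ℂ) ^ (s - 1) •
        (indicator (Ioc 0 1) (fun t : ℝ => (t : ℂ) ^ (-k : ℂ) * G t⁻¹)) t := by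
    -- The inverse image of `(1, ∞)` is `(0, 1)`, not `(0, 1]`; the point `1` is discarded as a null
    -- set.
    have h1 : ∀ᵐ t : ℝ ∂(volume.restrict (Ioi 0)), t ≠ 1 :=
      ae_restrict_of_ae (Measure.ae_ne volume 1)
    filter_upwards [ae_restrict_mem measurableSet_Ioi, h1] with t (ht : 0 < t) ht1
    by_cases h : 1 < t⁻¹
    · have h' : t < 1 := by simpa using (one_lt_inv₀ ht).mp h
      simp [indicator, h, h'.le, ht]
    · have h' : ¬ t ≤ 1 := by
        intro h2
        exact h ((one_lt_inv₀ ht).mpr (lt_of_le_of_ne h2 ht1))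
      simp [indicator, h, h']
  have hc : MellinConvergent (fun t : ℝ => (t : ℂ) ^ (-k : ℂ) •
      (fun t => indicator (Ioi 1) G t⁻¹) t) s := by
    rw [MellinConvergent.cpow_smul]
    have := (MellinConvergent.comp_rpow (f := indicator (Ioi 1) G) (s := s + -k) (a := -1)
      (by norm_num)).mpr (hG.indicator_mellinConvergent _)
    simpa [Real.rpow_neg_one] using this
  refine ⟨hc.congr key, ?_⟩
  rw [mellin, ← integral_congr_ae key]
  change mellin _ s = _
  rw [mellin_cpow_smul, mellin_comp_inv, neg_add, neg_neg, neg_add_eq_sub]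

/-- Hecke's argument for a pair of functions whose constant terms are `A + B y^{1-k}` and
`A' + B' y^{1-k}`. -/
lemma mellin_eq_entirePart (hF : RapidDecay σ F) (hG : RapidDecay σ G) (hσ : 1 ≤ σ) (hk : k < 0)
    {A B A' B' : ℂ}
    (h : ∀ y : ℝ, 0 < y → A + B * (y : ℂ) ^ (k - 1) + F y⁻¹
      = ε * (y : ℂ) ^ k * (A' + B' * (y : ℂ) ^ (1 - k) + G y)) {s : ℂ} (hs : σ < s.re) :
    mellin F s = entirePart k ε F G s
      - (A / s + ε * A' / (k - s) + B * (1 / (s - k + 1)) + ε * B' * (1 / (1 - s))) := by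
  have hkR : (k : ℝ) < 0 := by exact_mod_cast hk
  -- On `(0,1]` the relation at `y = 1/t` reads `F(t) = ε(A' t^{-k} + B' t^{-1} + t^{-k} G(1/t)) - A
  -- - B t^{1-k}`. The five transforms treat these pieces one by one; the term `t^{-1}` is the one
  -- that needs `Re s > 1`.
  have m1 := hasMellin_const_smul (hasMellin_one_Ioc (s := s) (by linarith)).1 A
  have m2 := hasMellin_const_smul (hasMellin_cpow_Ioc (1 - k) (s := s) (by simp; linarith)).1 B
  have m3 := hasMellin_const_smul (hasMellin_cpow_Ioc (-k) (s := s) (by simp; linarith)).1 (ε * A')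
  have m4 := hasMellin_const_smul (hasMellin_cpow_Ioc (-1) (s := s) (by simp; linarith)).1 (ε * B')
  have m5 := hasMellin_const_smul (hasMellin_indicator_comp_inv hG k s).1 ε
  have m34 := hasMellin_add m3.1 m4.1
  have m12 := hasMellin_add m1.1 m2.1
  have m := hasMellin_sub (hasMellin_add m34.1 m5.1).1 m12.1
  have e : mellin (indicator (Ioc 0 1) F) s = _ := Eq.trans (?_ : _ = mellin _ s) m.2
  · rw [mellin_eq_indicator_add hF hs, e, (hasMellin_add m34.1 m5.1).2, m34.2, m12.2, m1.2, m2.2,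
      m3.2, m4.2, m5.2, (hasMellin_one_Ioc (s := s) (by linarith)).2,
      (hasMellin_cpow_Ioc (1 - k) (s := s) (by simp; linarith)).2,
      (hasMellin_cpow_Ioc (-k) (s := s) (by simp; linarith)).2,
      (hasMellin_cpow_Ioc (-1) (s := s) (by simp; linarith)).2,
      (hasMellin_indicator_comp_inv hG k s).2, entirePart]
    have e1 : (1 : ℂ) / (s + -k) = -(1 / (k - s)) := by
      rw [show s + -(k : ℂ) = -(k - s) by ring, one_div, one_div, inv_neg]
    have e2 : (1 : ℂ) / (s + -1) = -(1 / (1 - s)) := by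
      rw [show s + -1 = -(1 - s) by ring, one_div, one_div, inv_neg]
    rw [e1, e2, show s + (1 - (k : ℂ)) = s - k + 1 by ring]
    simp only [smul_eq_mul]
    ring
  · refine setIntegral_congr_fun measurableSet_Ioi fun t (ht : 0 < t) => ?_
    by_cases h1 : t ≤ 1
    · have ht' : (t : ℂ) ≠ 0 := by exact_mod_cast ht.ne'
      have := h t⁻¹ (inv_pos.mpr ht)
      rw [inv_inv] at this
      have e1 : (t : ℂ) ^ (1 - k : ℂ) = (t : ℂ) ^ (1 - k) := by
        rw [← cpow_intCast]; push_cast; rfl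
      have e2 : (t : ℂ) ^ (-k : ℂ) = (t : ℂ) ^ (-k) := by
        rw [← cpow_intCast]; push_cast; rfl
      simp only [indicator, mem_Ioc, ht, h1, true_and, if_true, smul_eq_mul, e1, e2, cpow_neg_one]
      congr 1
      rw [show F t = ε * ((t⁻¹ : ℝ) : ℂ) ^ k * (A' + B' * ((t⁻¹ : ℝ) : ℂ) ^ (1 - k) + G t⁻¹)
        - A - B * ((t⁻¹ : ℝ) : ℂ) ^ (k - 1) by rw [← this]; ring]
      push_cast
      rw [inv_zpow', inv_zpow', inv_zpow', neg_sub]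
      have : (t : ℂ)⁻¹ = (t : ℂ) ^ (-k) * (t : ℂ) ^ (-(1 - k)) := by
        rw [← zpow_add₀ ht', show -k + -(1 - k) = -1 by ring, zpow_neg_one]
      rw [this, neg_sub]
      ring_nf
    · simp [indicator, h1]

end

/-! ### Kernels of exponential decay -/

/-- This is `log t ≤ t - 1` at `t = cx/β`, multiplied by `β`. -/
lemma rpow_le_mul_exp {β c x : ℝ} (hβ : 0 < β) (hc : 0 < c) (hx : 0 < x) :
    x ^ β ≤ (β / c) ^ β * Real.exp (c * x) := by
  have h1 : (c * x / β) ^ β ≤ Real.exp (c * x) := by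
    rw [Real.rpow_def_of_pos (by positivity), Real.exp_le_exp]
    have := Real.log_le_sub_one_of_pos (show 0 < c * x / β by positivity)
    calc _ ≤ (c * x / β - 1) * β := mul_le_mul_of_nonneg_right this hβ.le
      _ = c * x - β := by field_simp
      _ ≤ c * x := by linarith
  calc x ^ β = (β / c) ^ β * (c * x / β) ^ β := by
        rw [← Real.mul_rpow (by positivity) (by positivity)]; congr 1; field_simp
    _ ≤ _ := mul_le_mul_of_nonneg_left h1 (by positivity)

lemma rapidDecay_of_le_exp {K : ℝ → ℂ} {C c : ℝ} (hc : 0 < c) (hK : ContinuousOn K (Ioi 0))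
    (h : ∀ x : ℝ, 0 < x → ‖K x‖ ≤ C * Real.exp (-(c * x))) : RapidDecay 0 K := by
  refine ⟨hK, fun β hβ => ⟨C * (β / c) ^ β, fun x hx => (h x hx).trans ?_⟩⟩
  have hC : 0 ≤ C := by
    have := (norm_nonneg _).trans (h 1 one_pos)
    exact nonneg_of_mul_nonneg_left this (Real.exp_pos _)
  rw [mul_assoc]
  refine mul_le_mul_of_nonneg_left ?_ hC
  have hx' := Real.rpow_pos_of_pos hx β
  rw [Real.exp_neg, Real.rpow_neg hx.le, ← div_eq_mul_inv, inv_le_comm₀ (Real.exp_pos _)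
    (by positivity), inv_div, div_le_iff₀ (by positivity)]
  rw [mul_comm]
  exact rpow_le_mul_exp hβ hc hx

lemma RapidDecay.ofReal_mul {K : ℝ → ℂ} (hK : RapidDecay 0 K) :
    RapidDecay 0 (fun x : ℝ => (x : ℂ) * K x) := by
  refine ⟨continuous_ofReal.continuousOn.mul hK.1, fun β hβ => ?_⟩
  obtain ⟨C, hC⟩ := hK.2 (β + 1) (by linarith)
  refine ⟨C, fun x hx => ?_⟩
  rw [norm_mul, norm_real, Real.norm_of_nonneg hx.le]
  calc x * ‖K x‖ ≤ x * (C * x ^ (-(β + 1))) := mul_le_mul_of_nonneg_left (hC x hx) hx.le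
    _ = C * x ^ (-β) := by
      rw [show -β = -(β + 1) + 1 by ring, Real.rpow_add_one hx.ne']; ring

/-- The kernel `e^{-x}`. -/
def expKernel (x : ℝ) : ℂ := (Real.exp (-x) : ℝ)

/-- The kernel `Γ(1-k, 2x) e^x`. -/
def gammaKernel (k : ℤ) (x : ℝ) : ℂ := ((incGamma (1 - k) (2 * x) * Real.exp x : ℝ) : ℂ)

lemma rapidDecay_expKernel : RapidDecay 0 expKernel :=
  rapidDecay_of_le_exp (C := 1) one_pos (by unfold expKernel; fun_prop) fun x _ => by
    rw [expKernel, norm_real, Real.norm_of_nonneg (Real.exp_pos _).le]; simp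

/-! ### Continuity and exponential decay of the incomplete gamma function. -/

section incGamma

variable {ν : ℝ}

lemma integrableOn_exp_mul_rpow {c : ℝ} (hc : 0 < c) (hν : 0 < ν) :
    IntegrableOn (fun t : ℝ => Real.exp (-(c * t)) * t ^ (ν - 1)) (Ioi 0) := by
  refine (integrableOn_rpow_mul_exp_neg_mul_rpow (p := 1) (s := ν - 1) (by linarith) one_pos
    hc).congr_fun (fun t _ => ?_) measurableSet_Ioi
  simp only [Real.rpow_one]
  ring_nf

lemma continuousOn_incGamma (hν : 0 < ν) : ContinuousOn (incGamma ν) (Ioi 0) := by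
  set h : ℝ → ℝ := fun t => Real.exp (-t) * t ^ (ν - 1) with hh
  have hi : IntegrableOn h (Ioi 0) := by simpa using integrableOn_exp_mul_rpow one_pos hν
  have hc := (hi.integrable_indicator measurableSet_Ioi).continuous_primitive 0
  have hc' : Continuous fun y : ℝ => (∫ t in Ioi 0, h t) -
    ∫ t in (0 : ℝ)..y, indicator (Ioi 0) h t := continuous_const.sub hc
  refine hc'.continuousOn.congr fun y (hy : 0 < y) => ?_
  have e : ∫ t in (0 : ℝ)..y, indicator (Ioi 0) h t = ∫ t in (0 : ℝ)..y, h t := by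
    rw [intervalIntegral.integral_of_le hy.le, intervalIntegral.integral_of_le hy.le]
    exact setIntegral_congr_fun measurableSet_Ioc fun t ht => indicator_of_mem ht.1 _
  beta_reduce
  rw [e, ← intervalIntegral.integral_Ioi_sub_Ioi hi hy.le, sub_sub_cancel]
  rfl

lemma incGamma_nonneg {x : ℝ} (hx : 0 ≤ x) : 0 ≤ incGamma ν x :=
  setIntegral_nonneg measurableSet_Ioi fun t (ht : x < t) =>
    mul_nonneg (Real.exp_pos _).le (Real.rpow_nonneg (hx.trans ht.le) _)

/-- Write `e^{-t} = e^{-3t/4} e^{-t/4}` and bound the first factor by its value at `t = x`. Any rate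
above `1/2` would do: the argument of interest is `2x`, and the decay must beat the factor `e^x` of
`gammaKernel`. -/
lemma exists_incGamma_le (hν : 0 < ν) :
    ∃ C : ℝ, ∀ x : ℝ, 0 < x → incGamma ν x ≤ C * Real.exp (-(3 / 4 * x)) := by
  have hi := integrableOn_exp_mul_rpow (c := 1 / 4) (by norm_num) hν
  have hi1 : IntegrableOn (fun t : ℝ => Real.exp (-t) * t ^ (ν - 1)) (Ioi 0) := by
    simpa using integrableOn_exp_mul_rpow one_pos hν
  refine ⟨∫ t in Ioi (0 : ℝ), Real.exp (-(1 / 4 * t)) * t ^ (ν - 1), fun x hx => ?_⟩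
  have hs : Ioi x ⊆ Ioi 0 := Ioi_subset_Ioi hx.le
  rw [mul_comm]
  calc incGamma ν x
      ≤ ∫ t in Ioi x, Real.exp (-(3 / 4 * x)) * (Real.exp (-(1 / 4 * t)) * t ^ (ν - 1)) := by
        refine setIntegral_mono_on (hi1.mono_set hs) ((hi.mono_set hs).const_mul _)
          measurableSet_Ioi fun t (ht : x < t) => ?_
        rw [← mul_assoc, ← Real.exp_add]
        refine mul_le_mul_of_nonneg_right (Real.exp_le_exp.mpr (by linarith))
          (Real.rpow_nonneg (hx.le.trans ht.le) _)
    _ = Real.exp (-(3 / 4 * x)) * ∫ t in Ioi x, Real.exp (-(1 / 4 * t)) * t ^ (ν - 1) :=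
        integral_const_mul _ _
    _ ≤ _ := by
        refine mul_le_mul_of_nonneg_left ?_ (Real.exp_pos _).le
        refine setIntegral_mono_set hi ?_ (hs.eventuallyLE)
        filter_upwards [ae_restrict_mem measurableSet_Ioi] with t (ht : 0 < t)
        positivity

lemma rapidDecay_gammaKernel {k : ℤ} (hk : k < 0) : RapidDecay 0 (gammaKernel k) := by
  have hkR : (k : ℝ) < 0 := by exact_mod_cast hk
  have hν : (0 : ℝ) < 1 - k := by linarith
  obtain ⟨C, hC⟩ := exists_incGamma_le hν
  refine rapidDecay_of_le_exp (C := C) (c := 1 / 2) (by norm_num) ?_ fun x hx => ?_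
  · refine continuous_ofReal.comp_continuousOn (ContinuousOn.mul ?_ Real.continuous_exp.continuousOn)
    exact (continuousOn_incGamma hν).comp (by fun_prop) fun x (hx : 0 < x) => by
      simpa using hx
  · rw [gammaKernel, norm_real, norm_mul, Real.norm_of_nonneg (incGamma_nonneg (by positivity)),
      Real.norm_of_nonneg (Real.exp_pos _).le]
    calc _ ≤ C * Real.exp (-(3 / 4 * (2 * x))) * Real.exp x :=
          mul_le_mul_of_nonneg_right (hC _ (by positivity)) (Real.exp_pos _).le
      _ = _ := by rw [mul_assoc, ← Real.exp_add]; ring_nf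

end incGamma

lemma mellin_expKernel {s : ℂ} (hs : 0 < s.re) : mellin expKernel s = Gamma s := by
  rw [Gamma_eq_integral hs, GammaIntegral_eq_mellin]; rfl

lemma mellin_ofReal_mul (K : ℝ → ℂ) (s : ℂ) :
    mellin (fun x : ℝ => (x : ℂ) * K x) s = mellin K (s + 1) := by
  simpa using mellin_cpow_smul K s 1

/-! ### Series of dilated kernels -/

/-- `∑_{n ≥ 1} a(n) K(n t y)`. -/
def kernelSeries (a : ℕ → ℂ) (K : ℝ → ℂ) (t y : ℝ) : ℂ :=
  ∑' n : ℕ, a (n + 1) * K (((n : ℝ) + 1) * t * y)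

section kernelSeries

variable {a : ℕ → ℂ} {K : ℝ → ℂ} {t α C : ℝ}

/-- Trading `K(x)` for `x^{-β}` leaves `n^{α-β}`, which is summable exactly when `β > α + 1`. This
is the source of the abscissa `α + 1`. -/
lemma exists_norm_kernelSeries_term_le (ha : ∀ n : ℕ, 1 ≤ n → ‖a n‖ ≤ C * (n : ℝ) ^ α)
    (hK : RapidDecay 0 K) (ht : 0 < t) (hα : 0 ≤ α) {β : ℝ} (hβ : α + 1 < β) :
    ∃ D : ℝ, 0 ≤ D ∧ ∀ (n : ℕ) (y : ℝ), 0 < y →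
      ‖a (n + 1) * K (((n : ℝ) + 1) * t * y)‖ ≤ D * ((n : ℝ) + 1) ^ (α - β) * y ^ (-β) := by
  obtain ⟨B, hB⟩ := hK.2 β (by linarith)
  have hC : 0 ≤ C := by simpa using (norm_nonneg _).trans (ha 1 le_rfl)
  have hB0 : 0 ≤ B := by simpa using (norm_nonneg _).trans (hB 1 one_pos)
  refine ⟨C * B * t ^ (-β), by positivity, fun n y hy => ?_⟩
  have hn : (0 : ℝ) < (n : ℝ) + 1 := by positivity
  have h1 := ha (n + 1) (by omega)
  push_cast at h1
  rw [norm_mul]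
  calc _ ≤ (C * ((n : ℝ) + 1) ^ α) * (B * (((n : ℝ) + 1) * t * y) ^ (-β)) :=
        mul_le_mul h1 (hB _ (by positivity)) (norm_nonneg _) (by positivity)
    _ = _ := by
        rw [Real.mul_rpow (by positivity) hy.le, Real.mul_rpow hn.le ht.le, sub_eq_add_neg,
          Real.rpow_add hn]
        ring

lemma summable_natCast_add_one_rpow {p : ℝ} (hp : p < -1) :
    Summable fun n : ℕ => ((n : ℝ) + 1) ^ p := by
  have := (summable_nat_add_iff 1).mpr (Real.summable_nat_rpow.mpr hp)
  simpa using this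

lemma summable_kernelSeries (ha : ∀ n : ℕ, 1 ≤ n → ‖a n‖ ≤ C * (n : ℝ) ^ α)
    (hK : RapidDecay 0 K) (ht : 0 < t) (hα : 0 ≤ α) {y : ℝ} (hy : 0 < y) :
    Summable fun n : ℕ => a (n + 1) * K (((n : ℝ) + 1) * t * y) := by
  obtain ⟨D, hD0, hD⟩ := exists_norm_kernelSeries_term_le ha hK ht hα (β := α + 2) (by linarith)
  refine Summable.of_norm_bounded ?_ fun n => hD n y hy
  exact ((summable_natCast_add_one_rpow (by linarith)).mul_left D).mul_right _

lemma rapidDecay_kernelSeries (ha : ∀ n : ℕ, 1 ≤ n → ‖a n‖ ≤ C * (n : ℝ) ^ α)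
    (hK : RapidDecay 0 K) (ht : 0 < t) (hα : 0 ≤ α) :
    RapidDecay (α + 1) (kernelSeries a K t) := by
  constructor
  · obtain ⟨D, hD0, hD⟩ := exists_norm_kernelSeries_term_le ha hK ht hα (β := α + 2) (by linarith)
    intro y₀ (hy₀ : 0 < y₀)
    -- The majorant `y^{-β}` blows up at `0`, so uniform convergence is only claimed to the right of
    -- `y₀ / 2`.
    have key : ContinuousOn (kernelSeries a K t) (Ioi (y₀ / 2)) := by
      refine continuousOn_tsum (u := fun n : ℕ => D * ((n : ℝ) + 1) ^ (α - (α + 2))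
        * (y₀ / 2) ^ (-(α + 2))) (fun n => ?_) ?_ fun n y (hy : y₀ / 2 < y) => ?_
      · refine continuousOn_const.mul (hK.1.comp (by fun_prop) fun y (hy : y₀ / 2 < y) => ?_)
        have : 0 < y := by linarith
        simp only [mem_Ioi]
        positivity
      · exact ((summable_natCast_add_one_rpow (by linarith)).mul_left D).mul_right _
      · have : 0 < y := by linarith
        refine (hD n y this).trans (mul_le_mul_of_nonneg_left ?_ (by positivity))
        exact Real.rpow_le_rpow_of_nonpos (by linarith) hy.le (by linarith)
    exact (key.continuousAt (Ioi_mem_nhds (by linarith))).continuousWithinAt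
  · intro β hβ
    obtain ⟨D, hD0, hD⟩ := exists_norm_kernelSeries_term_le ha hK ht hα hβ
    have hs := (summable_natCast_add_one_rpow (p := α - β) (by linarith)).mul_left D
    refine ⟨∑' n : ℕ, D * ((n : ℝ) + 1) ^ (α - β), fun y hy => ?_⟩
    rw [← tsum_mul_right]
    exact tsum_of_norm_bounded (hs.mul_right _).hasSum fun n => hD n y hy

lemma LSeries_eq_tsum_add_one (a : ℕ → ℂ) (s : ℂ) (h : LSeriesSummable a s) :
    LSeries a s = ∑' n : ℕ, a (n + 1) / ((n : ℂ) + 1) ^ s := by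
  rw [LSeries, h.tsum_eq_zero_add]
  simp

lemma integral_norm_mellin_comp_mul_left (K : ℝ → ℂ) (s : ℂ) {b : ℝ} (hb : 0 < b) :
    ∫ y in Ioi (0 : ℝ), ‖(y : ℂ) ^ (s - 1) • K (b * y)‖
      = b ^ (-s.re) * ∫ y in Ioi (0 : ℝ), ‖(y : ℂ) ^ (s - 1) • K y‖ := by
  have e : ∀ y ∈ Ioi (0 : ℝ), ‖(y : ℂ) ^ (s - 1) • K (b * y)‖
      = b ^ (1 - s.re) * (fun u : ℝ => ‖(u : ℂ) ^ (s - 1) • K u‖) (b * y) := by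
    intro y (hy : 0 < y)
    simp only [norm_smul]
    rw [norm_cpow_eq_rpow_re_of_pos hy, norm_cpow_eq_rpow_re_of_pos (by positivity),
      Real.mul_rpow hb.le hy.le, ← mul_assoc, ← mul_assoc, ← Real.rpow_add hb]
    simp
  have c := integral_comp_mul_left_Ioi (fun u : ℝ => ‖(u : ℂ) ^ (s - 1) • K u‖) 0 hb
  rw [mul_zero] at c
  rw [setIntegral_congr_fun measurableSet_Ioi e, integral_const_mul, c, smul_eq_mul, ← mul_assoc]
  congr 1
  rw [← Real.rpow_neg_one, ← Real.rpow_add hb]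
  congr 1
  ring

/-- Rescaling turns each term into `a(n) (nt)^{-s}` times one fixed Mellin transform. The same
scaling of the integrals of norms reduces the interchange of sum and integral to absolute
convergence of the Dirichlet series. -/
lemma mellin_kernelSeries (ha : ∀ n : ℕ, 1 ≤ n → ‖a n‖ ≤ C * (n : ℝ) ^ α)
    (hK : RapidDecay 0 K) (ht : 0 < t) (hα : 0 ≤ α) {s : ℂ} (hs : α + 1 < s.re) :
    mellin (kernelSeries a K t) s = (t : ℂ) ^ (-s) * (mellin K s * LSeries a s) := by
  have hL : LSeriesSummable a s := LSeriesSummable_of_le_const_mul_rpow hs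
    ⟨C, fun n hn => by simpa using ha n (Nat.one_le_iff_ne_zero.mpr hn)⟩
  have hpos : ∀ n : ℕ, 0 < ((n : ℝ) + 1) * t := fun n => by positivity
  have hKs := hK.mellinConvergent (s := s) (by linarith)
  have hint : ∀ n : ℕ, MellinConvergent (fun y => a (n + 1) • K (((n : ℝ) + 1) * t * y)) s :=
    fun n => ((MellinConvergent.comp_mul_left (hpos n)).mpr hKs).const_smul _
  have hterm : ∀ n : ℕ, ∫ y in Ioi (0 : ℝ),
      ‖(y : ℂ) ^ (s - 1) • (a (n + 1) • K (((n : ℝ) + 1) * t * y))‖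
      = ‖LSeries.term a s (n + 1)‖ *
        (t ^ (-s.re) * ∫ y in Ioi (0 : ℝ), ‖(y : ℂ) ^ (s - 1) • K y‖) := by
    intro n
    have hn : (0 : ℝ) < (n : ℝ) + 1 := by positivity
    simp_rw [smul_comm _ (a (n + 1))]
    simp_rw [norm_smul (a (n + 1))]
    rw [integral_const_mul, integral_norm_mellin_comp_mul_left K s (hpos n),
      LSeries.term_of_ne_zero (Nat.succ_ne_zero n), norm_div,
      norm_natCast_cpow_of_pos (Nat.succ_pos n), Real.mul_rpow hn.le ht.le, Real.rpow_neg hn.le]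
    push_cast
    ring
  have hsum := hasSum_integral_of_summable_integral_norm hint (by
    simp_rw [hterm]
    exact ((summable_nat_add_iff 1).mpr hL.norm).mul_right _)
  have h1 : mellin (kernelSeries a K t) s = ∑' n : ℕ,
      mellin (fun y => a (n + 1) • K (((n : ℝ) + 1) * t * y)) s := by
    refine Eq.trans (setIntegral_congr_fun measurableSet_Ioi fun y (hy : 0 < y) => ?_)
      hsum.tsum_eq.symm
    simp only [kernelSeries, smul_eq_mul]
    rw [tsum_mul_left]
  rw [h1, LSeries_eq_tsum_add_one a s hL, ← tsum_mul_left, ← tsum_mul_left]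
  refine tsum_congr fun n => ?_
  have hn : (0 : ℝ) < (n : ℝ) + 1 := by positivity
  rw [mellin_const_smul, mellin_comp_mul_left _ _ (hpos n), ofReal_mul,
    mul_cpow_ofReal_nonneg hn.le ht.le, cpow_neg ((((n : ℝ) + 1 : ℝ)) : ℂ)]
  push_cast
  simp only [smul_eq_mul]
  ring

end kernelSeries

/-! ### Hecke's correspondence for pairs of functions -/

/-- The polar part of the Mellin transform of `F`, when
`A + B y^{1-k} + F(y)` corresponds to `A' + B' y^{1-k} + G(y)` under `y ↦ 1/y`. -/
def polarPart (k : ℤ) (ε A B A' B' s : ℂ) : ℂ :=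
  A / s + ε * A' / (k - s) + B * (1 / (s - k + 1)) + ε * B' * (1 / (1 - s))

/-- The functions `D` and `D'` on `Re s > σ` differ by the polar parts from entire functions that
are bounded in vertical strips and satisfy the functional equation `E(s) = ε E'(k-s)`. -/
def HasHeckeContinuation (k : ℤ) (σ : ℝ) (ε A B A' B' : ℂ) (D D' : ℂ → ℂ) : Prop :=
  ∃ E E' : ℂ → ℂ, (Differentiable ℂ E ∧ BoundedInVerticalStrips E) ∧
    (Differentiable ℂ E' ∧ BoundedInVerticalStrips E') ∧ (∀ s, E s = ε * E' (k - s)) ∧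
    (∀ s : ℂ, σ < s.re → D s = E s - polarPart k ε A B A' B' s) ∧
    (∀ s : ℂ, σ < s.re → D' s = E' s - polarPart k ε⁻¹ A' B' A B s)

lemma hasHeckeContinuation_mellin {σ : ℝ} {F G : ℝ → ℂ} {k : ℤ} {ε : ℂ} (hF : RapidDecay σ F)
    (hG : RapidDecay σ G) (hσ : 1 ≤ σ) (hk : k < 0) (hε : ε ≠ 0) {A B A' B' : ℂ}
    (h : ∀ y : ℝ, 0 < y → A + B * (y : ℂ) ^ (k - 1) + F y⁻¹
      = ε * (y : ℂ) ^ k * (A' + B' * (y : ℂ) ^ (1 - k) + G y)) :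
    HasHeckeContinuation k σ ε A B A' B' (mellin F) (mellin G) := by
  refine ⟨entirePart k ε F G, entirePart k ε⁻¹ G F,
    ⟨differentiable_entirePart hF hG, boundedInVerticalStrips_entirePart hF hG⟩,
    ⟨differentiable_entirePart hG hF, boundedInVerticalStrips_entirePart hG hF⟩,
    entirePart_functional_equation hε, fun s hs => mellin_eq_entirePart hF hG hσ hk h hs,
    fun s hs => mellin_eq_entirePart hG hF hσ hk (fun y hy => ?_) hs⟩
  have hy' : (y : ℂ) ≠ 0 := by exact_mod_cast hy.ne'
  -- The hypothesis is symmetric: `y ↦ 1/y` exchanges the two functions and replaces `ε` by `ε⁻¹`.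
  have := h y⁻¹ (inv_pos.mpr hy)
  rw [inv_inv] at this
  push_cast at this
  rw [inv_zpow', inv_zpow', inv_zpow', neg_sub, neg_sub] at this
  rw [add_assoc A, add_comm (B * _), ← add_assoc] at this
  rw [add_right_comm A, this]
  have e : (y : ℂ) ^ k * (y : ℂ) ^ (-k) = 1 := by rw [← zpow_add₀ hy']; simp
  rw [show ε⁻¹ * (y : ℂ) ^ k * (ε * (y : ℂ) ^ (-k) * (A' + B' * (y : ℂ) ^ (k - 1) + G y⁻¹))
    = (ε⁻¹ * ε) * ((y : ℂ) ^ k * (y : ℂ) ^ (-k)) * (A' + B' * (y : ℂ) ^ (k - 1) + G y⁻¹) by ring,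
    e, inv_mul_cancel₀ hε, one_mul, one_mul]

/-! ### Fourier series along vertical lines -/

/-- The function on the upper half-plane with given Fourier coefficients. -/
def fourierFun (k : ℤ) (c : FourierCoeffs) (z : ℂ) : ℂ :=
  (∑' n : ℕ, c.plus n * exp (2 * Real.pi * I * (n : ℂ) * z))
    + c.minus 0 * ((z.im ^ (1 - k) : ℝ) : ℂ)
    + ∑' n : ℕ, c.minus (n + 1)
        * ((incGamma (1 - k) (4 * Real.pi * ((n : ℝ) + 1) * z.im) : ℝ) : ℂ)
        * exp (-(2 * Real.pi * I * ((n : ℂ) + 1) * z))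

/-- `∑_{n≠0}` of the Fourier series at `i y / R`. -/
def cuspPart (k : ℤ) (R : ℝ) (c : FourierCoeffs) (y : ℝ) : ℂ :=
  kernelSeries c.plus expKernel (2 * Real.pi / R) y
    + kernelSeries c.minus (gammaKernel k) (2 * Real.pi / R) y

/-- The function `-i v ∂f/∂u` at `τ = i v`, `v = y / R`. -/
def derivPart (k : ℤ) (R : ℝ) (c : FourierCoeffs) (y : ℝ) : ℂ :=
  kernelSeries c.plus (fun x => x * expKernel x) (2 * Real.pi / R) y
    + -1 * kernelSeries c.minus (fun x => x * gammaKernel k x) (2 * Real.pi / R) y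

section

variable {k : ℤ} {c d : FourierCoeffs} {α R : ℝ}

lemma rapidDecay_cuspPart (hk : k < 0) (hc : c.IsBigO α) (hα : 0 ≤ α) (hR : 0 < R) :
    RapidDecay (α + 1) (cuspPart k R c) := by
  obtain ⟨C, hC⟩ := hc
  exact (rapidDecay_kernelSeries (fun n hn => (hC n hn).1) rapidDecay_expKernel
    (by positivity) hα).add (rapidDecay_kernelSeries (fun n hn => (hC n hn).2)
      (rapidDecay_gammaKernel hk) (by positivity) hα)

lemma rapidDecay_derivPart (hk : k < 0) (hc : c.IsBigO α) (hα : 0 ≤ α) (hR : 0 < R) :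
    RapidDecay (α + 1) (derivPart k R c) := by
  obtain ⟨C, hC⟩ := hc
  exact (rapidDecay_kernelSeries (fun n hn => (hC n hn).1) rapidDecay_expKernel.ofReal_mul
    (by positivity) hα).add ((rapidDecay_kernelSeries (fun n hn => (hC n hn).2)
      (rapidDecay_gammaKernel hk).ofReal_mul (by positivity) hα).const_mul _)

lemma cpow_neg_two_pi_div (hR : 0 < R) (s : ℂ) :
    ((2 * Real.pi / R : ℝ) : ℂ) ^ (-s) = ((R / (2 * Real.pi) : ℝ) : ℂ) ^ s := by
  have hp : (0 : ℝ) < R / (2 * Real.pi) := by positivity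
  rw [show 2 * Real.pi / R = (R / (2 * Real.pi))⁻¹ by rw [inv_div], ofReal_inv, cpow_neg,
    inv_cpow, inv_inv]
  rw [arg_ofReal_of_nonneg hp.le]
  exact Real.pi_pos.ne

lemma mellin_cuspPart (hk : k < 0) (hc : c.IsBigO α) (hα : 0 ≤ α) (hR : 0 < R) {s : ℂ}
    (hs : α + 1 < s.re) : mellin (cuspPart k R c) s = scaledLambda k R c s := by
  obtain ⟨C, hC⟩ := hc
  have ht : 0 < 2 * Real.pi / R := by positivity
  have hp := fun n hn => (hC n hn).1
  have hm := fun n hn => (hC n hn).2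
  have h1 := rapidDecay_kernelSeries hp rapidDecay_expKernel ht hα
  have h2 := rapidDecay_kernelSeries hm (rapidDecay_gammaKernel hk) ht hα
  refine (hasMellin_add (h1.mellinConvergent hs) (h2.mellinConvergent hs)).2.trans ?_
  rw [mellin_kernelSeries hp rapidDecay_expKernel ht hα hs,
    mellin_kernelSeries hm (rapidDecay_gammaKernel hk) ht hα hs,
    mellin_expKernel (by linarith), cpow_neg_two_pi_div hR, ← mul_add]
  rfl

lemma mellin_derivPart (hk : k < 0) (hc : c.IsBigO α) (hα : 0 ≤ α) (hR : 0 < R) {s : ℂ}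
    (hs : α + 1 < s.re) : mellin (derivPart k R c) s = scaledXi k R c s := by
  obtain ⟨C, hC⟩ := hc
  have ht : 0 < 2 * Real.pi / R := by positivity
  have hp := fun n hn => (hC n hn).1
  have hm := fun n hn => (hC n hn).2
  have h1 := rapidDecay_kernelSeries hp rapidDecay_expKernel.ofReal_mul ht hα
  have h2 := rapidDecay_kernelSeries hm (rapidDecay_gammaKernel hk).ofReal_mul ht hα
  refine (hasMellin_add (h1.mellinConvergent hs)
    ((h2.const_mul (-1)).mellinConvergent hs)).2.trans ?_
  have e := mellin_const_smul (kernelSeries c.minus (fun x => x * gammaKernel k x)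
    (2 * Real.pi / R)) s (-1 : ℂ)
  simp only [smul_eq_mul] at e
  rw [e, mellin_kernelSeries hp rapidDecay_expKernel.ofReal_mul ht hα hs,
    mellin_kernelSeries hm (rapidDecay_gammaKernel hk).ofReal_mul ht hα hs, mellin_ofReal_mul,
    mellin_ofReal_mul, mellin_expKernel (by simp; linarith), cpow_neg_two_pi_div hR, scaledXi,
    LPlus, LMinus, show mellin (gammaKernel k) = W (1 - k) from rfl]
  ring

lemma mellin_neg_two_mul_derivPart_add (hk : k < 0) (hc : c.IsBigO α) (hα : 0 ≤ α) (hR : 0 < R)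
    {s : ℂ} (hs : α + 1 < s.re) :
    mellin (fun y => -2 * derivPart k R c y + k * cuspPart k R c y) s = scaledOmega k R c s := by
  have h1 := (rapidDecay_derivPart hk hc hα hR).const_mul (-2)
  have h2 := (rapidDecay_cuspPart hk hc hα hR).const_mul k
  rw [(hasMellin_add (h1.mellinConvergent hs) (h2.mellinConvergent hs)).2, scaledOmega,
    ← mellin_cuspPart hk hc hα hR hs, ← mellin_derivPart hk hc hα hR hs]
  have e1 := mellin_const_smul (derivPart k R c) s (-2 : ℂ)
  have e2 := mellin_const_smul (cuspPart k R c) s (k : ℂ)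
  simp only [smul_eq_mul] at e1 e2
  rw [e1, e2]

lemma plus_mul_exp (n : ℕ) (u y : ℝ) :
    c.plus (n + 1) * exp (2 * Real.pi * I * ((n + 1 : ℕ) : ℂ) * (u + I * (y / R)))
      = c.plus (n + 1) * expKernel (((n : ℝ) + 1) * (2 * Real.pi / R) * y)
          * exp (2 * Real.pi * I * 1 * ((n : ℂ) + 1) * u) := by
  rw [mul_assoc (c.plus _), expKernel, ofReal_exp, ← Complex.exp_add]
  congr 2
  push_cast
  linear_combination (2 * Real.pi * ((n : ℂ) + 1) * (y / R)) * I_sq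

/-- With `x = 2π(n+1)y/R`, the negative frequency contributes the growing factor `e^x` and the
incomplete gamma function has argument `2x`; together they form `gammaKernel`. The sign of the
frequency is kept as an explicit factor so that both halves of the series share the later lemmas. -/
lemma minus_mul_incGamma_mul_exp (n : ℕ) (u y : ℝ) :
    c.minus (n + 1) * ((incGamma (1 - k) (4 * Real.pi * ((n : ℝ) + 1) * (y / R)) : ℝ) : ℂ)
        * exp (-(2 * Real.pi * I * ((n : ℂ) + 1) * (u + I * (y / R))))
      = c.minus (n + 1) * gammaKernel k (((n : ℝ) + 1) * (2 * Real.pi / R) * y)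
          * exp (2 * Real.pi * I * (-1) * ((n : ℂ) + 1) * u) := by
  rw [gammaKernel, show 2 * (((n : ℝ) + 1) * (2 * Real.pi / R) * y)
    = 4 * Real.pi * ((n : ℝ) + 1) * (y / R) by ring, ofReal_mul, ofReal_exp,
    ← mul_assoc (c.minus _), mul_assoc (c.minus _ * _), ← Complex.exp_add]
  congr 2
  push_cast
  linear_combination (-(2 * Real.pi * ((n : ℂ) + 1) * (y / R))) * I_sq

lemma norm_exp_two_pi_I_mul (n : ℕ) (e u : ℝ) :
    ‖exp (2 * Real.pi * I * e * ((n : ℂ) + 1) * u)‖ = 1 := by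
  rw [show (2 * Real.pi * I * e * ((n : ℂ) + 1) * u : ℂ)
    = ((2 * Real.pi * e * ((n : ℝ) + 1) * u : ℝ) : ℂ) * I by push_cast; ring,
    norm_exp_ofReal_mul_I]

lemma summable_fourier_plus (hc : c.IsBigO α) (hα : 0 ≤ α) {z : ℂ} (hz : 0 < z.im) :
    Summable fun n : ℕ => c.plus n * exp (2 * Real.pi * I * (n : ℂ) * z) := by
  obtain ⟨C, hC⟩ := hc
  have := summable_kernelSeries (t := 2 * Real.pi / (1 : ℝ)) (fun n hn => (hC n hn).1)
    rapidDecay_expKernel (by positivity) hα hz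
  refine (summable_nat_add_iff (f := fun n : ℕ => c.plus n * exp (2 * Real.pi * I
    * (n : ℂ) * z)) 1).mp (Summable.of_norm_bounded this.norm fun n => le_of_eq ?_)
  have e := plus_mul_exp (c := c) (R := 1) n z.re z.im
  have h1 := norm_exp_two_pi_I_mul n 1 z.re
  rw [ofReal_one] at h1
  rw [ofReal_one, div_one, mul_comm I, re_add_im] at e
  rw [e, norm_mul, h1, mul_one]

lemma summable_fourier_minus (hk : k < 0) (hc : c.IsBigO α) (hα : 0 ≤ α) {z : ℂ} (hz : 0 < z.im) :
    Summable fun n : ℕ => c.minus (n + 1)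
      * ((incGamma (1 - k) (4 * Real.pi * ((n : ℝ) + 1) * z.im) : ℝ) : ℂ)
      * exp (-(2 * Real.pi * I * ((n : ℂ) + 1) * z)) := by
  obtain ⟨C, hC⟩ := hc
  have := summable_kernelSeries (t := 2 * Real.pi / (1 : ℝ)) (fun n hn => (hC n hn).2)
    (rapidDecay_gammaKernel hk) (by positivity) hα hz
  refine Summable.of_norm_bounded this.norm fun n => le_of_eq ?_
  have e := minus_mul_incGamma_mul_exp (k := k) (c := c) (R := 1) n z.re z.im
  have h1 := norm_exp_two_pi_I_mul n (-1) z.re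
  rw [ofReal_neg, ofReal_one] at h1
  rw [ofReal_one, div_one, div_one, mul_comm I (z.im : ℂ), re_add_im] at e
  rw [e, norm_mul, h1, mul_one]

lemma fourierFun_eq (hc : c.IsBigO α) (hα : 0 ≤ α) (hR : 0 < R) {y : ℝ} (hy : 0 < y) (u : ℝ) :
    fourierFun k c (u + I * (y / R)) = c.plus 0 + c.minus 0 / (R : ℂ) ^ (1 - k) * (y : ℂ) ^ (1 - k)
      + ((∑' n : ℕ, c.plus (n + 1) * expKernel (((n : ℝ) + 1) * (2 * Real.pi / R) * y)
          * exp (2 * Real.pi * I * 1 * ((n : ℂ) + 1) * u))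
        + ∑' n : ℕ, c.minus (n + 1) * gammaKernel k (((n : ℝ) + 1) * (2 * Real.pi / R) * y)
          * exp (2 * Real.pi * I * (-1) * ((n : ℂ) + 1) * u)) := by
  have him : ((u : ℂ) + I * (y / R)).im = y / R := by
    rw [← ofReal_div]; simp
  have hs := summable_fourier_plus hc hα (z := (u : ℂ) + I * (y / R)) (by rw [him]; positivity)
  rw [fourierFun, him, hs.tsum_eq_zero_add, tsum_congr fun n => plus_mul_exp n u y,
    tsum_congr fun n => minus_mul_incGamma_mul_exp n u y]
  have e : ((((y / R) ^ (1 - k) : ℝ)) : ℂ) = (y : ℂ) ^ (1 - k) / (R : ℂ) ^ (1 - k) := by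
    push_cast
    rw [div_zpow]
  rw [e]
  simp only [Nat.cast_zero, mul_zero, zero_mul, Complex.exp_zero, mul_one]
  ring

lemma fourierFun_I_mul (hc : c.IsBigO α) (hα : 0 ≤ α) (hR : 0 < R) {y : ℝ}
    (hy : 0 < y) :
    fourierFun k c (I * (y / R)) = c.plus 0 + c.minus 0 / (R : ℂ) ^ (1 - k) * (y : ℂ) ^ (1 - k)
      + cuspPart k R c y := by
  have := fourierFun_eq (k := k) hc hα hR hy 0
  simp only [ofReal_zero, zero_add, mul_zero, Complex.exp_zero, mul_one] at this
  exact this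

/-- Differentiating in `u` brings down `2πie(n+1)`, which is `2πie/(ty)` times the argument `x` of
the kernel; thus `K(x)` becomes `x K(x)`. The exponentials are unimodular, so the differentiated
series has a majorant independent of `u`. -/
lemma hasDerivAt_tsum_kernel {a : ℕ → ℂ} {K : ℝ → ℂ} {t C : ℝ}
    (ha : ∀ n : ℕ, 1 ≤ n → ‖a n‖ ≤ C * (n : ℝ) ^ α) (hK : RapidDecay 0 K) (ht : 0 < t)
    (hα : 0 ≤ α) {y : ℝ} (hy : 0 < y) (e : ℝ) :
    HasDerivAt (fun u : ℝ => ∑' n : ℕ, a (n + 1) * K (((n : ℝ) + 1) * t * y)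
        * exp (2 * Real.pi * I * e * ((n : ℂ) + 1) * u))
      (2 * Real.pi * I * e / (t * y) * kernelSeries a (fun x => x * K x) t y) 0 := by
  have hs := summable_kernelSeries ha hK ht hα hy
  have hs' := summable_kernelSeries ha hK.ofReal_mul ht hα hy
  have ht' : (t : ℂ) ≠ 0 := by exact_mod_cast ht.ne'
  have hy' : (y : ℂ) ≠ 0 := by exact_mod_cast hy.ne'
  have key := hasDerivAt_tsum (𝕜 := ℝ) (y₀ := 0) (u := fun n : ℕ =>
    ‖2 * Real.pi * I * e / (t * y) * (a (n + 1)
      * (((((n : ℝ) + 1) * t * y : ℝ) : ℂ) * K (((n : ℝ) + 1) * t * y)))‖)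
    (g := fun (n : ℕ) (u : ℝ) => a (n + 1) * K (((n : ℝ) + 1) * t * y)
        * exp (2 * Real.pi * I * e * ((n : ℂ) + 1) * u))
    (g' := fun (n : ℕ) (u : ℝ) => (2 * Real.pi * I * e / (t * y) * (a (n + 1)
      * (((((n : ℝ) + 1) * t * y : ℝ) : ℂ) * K (((n : ℝ) + 1) * t * y))))
        * exp (2 * Real.pi * I * e * ((n : ℂ) + 1) * u)) (hs'.mul_left _).norm
    (fun n u => ?_) (fun n u => ?_) ?_ 0
  · simp only [ofReal_zero, mul_zero, Complex.exp_zero, mul_one] at key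
    rw [tsum_mul_left] at key
    exact key
  · have h1 : HasDerivAt (fun u : ℝ => exp (2 * Real.pi * I * e * ((n : ℂ) + 1) * u))
        (exp (2 * Real.pi * I * e * ((n : ℂ) + 1) * u) * (2 * Real.pi * I * e * ((n : ℂ) + 1)))
        u := by
      have := ((hasDerivAt_id (u : ℂ)).const_mul (2 * Real.pi * I * e * ((n : ℂ) + 1))).cexp
      simpa using this.comp_ofReal
    refine (h1.const_mul (a (n + 1) * K (((n : ℝ) + 1) * t * y))).congr_deriv ?_
    push_cast
    field_simp
  · rw [norm_mul, norm_exp_two_pi_I_mul, mul_one]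
  · simpa using hs

lemma hasDerivAt_fourierFun (hk : k < 0) (hc : c.IsBigO α) (hα : 0 ≤ α) (hR : 0 < R) {y : ℝ}
    (hy : 0 < y) :
    HasDerivAt (fun u : ℝ => fourierFun k c (u + I * (y / R))) (I * (R / y) * derivPart k R c y)
      0 := by
  have he := fourierFun_eq (k := k) hc hα hR hy
  obtain ⟨C, hC⟩ := hc
  have ht : 0 < 2 * Real.pi / R := by positivity
  have h1 := hasDerivAt_tsum_kernel (fun n hn => (hC n hn).1) rapidDecay_expKernel ht hα hy 1
  have h2 := hasDerivAt_tsum_kernel (fun n hn => (hC n hn).2) (rapidDecay_gammaKernel hk) ht hα hy (-1)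
  push_cast at h1 h2
  have h3 := (h1.add h2).const_add
    (c.plus 0 + c.minus 0 / (R : ℂ) ^ (1 - k) * (y : ℂ) ^ (1 - k))
  rw [funext he]
  -- For `t = 2π/R` the factor `2πi/(ty)` is `iR/y`, and `e = -1` produces the minus sign in
  -- `derivPart`.
  refine h3.congr_deriv ?_
  have hR' : (R : ℂ) ≠ 0 := by exact_mod_cast hR.ne'
  have hy' : (y : ℂ) ≠ 0 := by exact_mod_cast hy.ne'
  have hpi : (Real.pi : ℂ) ≠ 0 := by exact_mod_cast Real.pi_ne_zero
  rw [derivPart]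
  field_simp

/-! ### Functional equations from a transformation law -/

variable {C : ℂ}

lemma neg_one_div_sq_mul (hR : 0 < R) {y : ℝ} (hy : 0 < y) :
    -1 / ((R : ℂ) ^ 2 * (I * (y / R))) = I * ((y⁻¹ : ℝ) / R) := by
  have hR' : (R : ℂ) ≠ 0 := by exact_mod_cast hR.ne'
  have hy' : (y : ℂ) ≠ 0 := by exact_mod_cast hy.ne'
  push_cast
  field_simp
  rw [I_sq]

lemma cuspPart_inv (hc : c.IsBigO α) (hd : d.IsBigO α) (hα : 0 ≤ α) (hR : 0 < R)
    (h : ∀ z : ℂ, 0 < z.im →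
      fourierFun k c (-1 / ((R : ℂ) ^ 2 * z)) = C * (R * z) ^ k * fourierFun k d z)
    {y : ℝ} (hy : 0 < y) :
    c.plus 0 + c.minus 0 / (R : ℂ) ^ (1 - k) * (y : ℂ) ^ (k - 1) + cuspPart k R c y⁻¹
      = (I ^ k * C) * (y : ℂ) ^ k * (d.plus 0 + d.minus 0 / (R : ℂ) ^ (1 - k)
        * (y : ℂ) ^ (1 - k) + cuspPart k R d y) := by
  have hR' : (R : ℂ) ≠ 0 := by exact_mod_cast hR.ne'
  have := h (I * (y / R)) (by rw [← ofReal_div]; simp; positivity)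
  rw [neg_one_div_sq_mul hR hy, fourierFun_I_mul hc hα hR (inv_pos.mpr hy),
    fourierFun_I_mul hd hα hR hy, show (R : ℂ) * (I * (y / R)) = I * y by field_simp,
    mul_zpow, ofReal_inv, inv_zpow', neg_sub] at this
  rw [this]
  ring

/-- Both sides of the transformation law are differentiated along the horizontal line through
`iy/R`. The left side runs through a curve that is not horizontal, so the chain rule needs real
differentiability in both variables. -/
lemma derivPart_inv (hk : k < 0) (hc : c.IsBigO α) (hd : d.IsBigO α) (hα : 0 ≤ α) (hR : 0 < R)
    (hdiff : ∀ z : ℂ, 0 < z.im → DifferentiableAt ℝ (fourierFun k c) z)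
    (h : ∀ z : ℂ, 0 < z.im →
      fourierFun k c (-1 / ((R : ℂ) ^ 2 * z)) = C * (R * z) ^ k * fourierFun k d z)
    {y : ℝ} (hy : 0 < y) :
    derivPart k R c y⁻¹ = (I ^ k * C) * (y : ℂ) ^ k * (-derivPart k R d y
      + k * fourierFun k d (I * (y / R))) := by
  have hR' : (R : ℂ) ≠ 0 := by exact_mod_cast hR.ne'
  have hy' : (y : ℂ) ≠ 0 := by exact_mod_cast hy.ne'
  set w : ℂ := I * (y / R) with hw
  have hw0 : w ≠ 0 := mul_ne_zero I_ne_zero (div_ne_zero hy' hR')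
  have hw' : -1 / ((R : ℂ) ^ 2 * w) = I * ((y⁻¹ : ℝ) / R) := neg_one_div_sq_mul hR hy
  have hp : DifferentiableAt ℝ (fourierFun k c) (-1 / ((R : ℂ) ^ 2 * w)) :=
    hdiff _ (by rw [hw', ← ofReal_div]; simp; positivity)
  -- the derivative of `u ↦ f(u + i / (R y))`
  have hL : fderiv ℝ (fourierFun k c) (-1 / ((R : ℂ) ^ 2 * w)) 1
      = I * (R / (y⁻¹ : ℝ)) * derivPart k R c y⁻¹ := by
    refine HasDerivAt.unique ?_ (hasDerivAt_fourierFun hk hc hα hR (inv_pos.mpr hy))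
    have h1 : HasDerivAt (fun u : ℝ => (u : ℂ) + I * ((y⁻¹ : ℝ) / R)) 1 0 := by
      simpa using (ofRealCLM.hasDerivAt (x := (0 : ℝ))).add_const (I * ((y⁻¹ : ℝ) / R) : ℂ)
    refine HasFDerivAt.comp_hasDerivAt (l := fourierFun k c)
      (f := fun u : ℝ => (u : ℂ) + I * ((y⁻¹ : ℝ) / R)) 0 ?_ h1
    simp only [ofReal_zero, zero_add]
    rw [← hw']
    exact hp.hasFDerivAt
  have hlin : ∀ x : ℝ, HasDerivAt (fun u : ℝ => (u : ℂ) + w) 1 x := fun x => by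
    simpa using (ofRealCLM.hasDerivAt (x := x)).add_const w
  -- At `w = iy/R` the inversion has derivative `1/(Rw)² = -1/y²`. It is real, so the image curve is
  -- tangent to the horizontal direction and `∂/∂v` does not enter.
  have hinv : HasDerivAt (fun u : ℝ => -1 / ((R : ℂ) ^ 2 * (u + w))) (((-(y ^ 2)⁻¹ : ℝ) : ℂ)) 0 := by
    have h2 := ((hlin 0).const_mul ((R : ℂ) ^ 2)).inv (by simpa using ⟨hR.ne', hw0⟩)
    have h3 := h2.const_mul (-1)
    simp only [ofReal_zero, zero_add] at h3
    refine h3.congr_deriv ?_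
    push_cast
    rw [hw]
    field_simp
    rw [I_sq]
    ring
  have hleft : HasDerivAt (fun u : ℝ => fourierFun k c (-1 / ((R : ℂ) ^ 2 * (u + w))))
      (((-(y ^ 2)⁻¹ : ℝ) : ℂ) * (I * (R / (y⁻¹ : ℝ)) * derivPart k R c y⁻¹)) 0 := by
    have h4 : HasFDerivAt (fourierFun k c) (fderiv ℝ (fourierFun k c) (-1 / ((R : ℂ) ^ 2 * w)))
        (-1 / ((R : ℂ) ^ 2 * (((0 : ℝ) : ℂ) + w))) := by
      simp only [ofReal_zero, zero_add]
      exact hp.hasFDerivAt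
    have h5 := h4.comp_hasDerivAt (f := fun u : ℝ => -1 / ((R : ℂ) ^ 2 * (u + w))) 0 hinv
    refine h5.congr_deriv ?_
    rw [← hL, show (((-(y ^ 2)⁻¹ : ℝ)) : ℂ) = (-(y ^ 2)⁻¹ : ℝ) • (1 : ℂ) by simp, map_smul]
    simp
  -- The derivative of the automorphy factor is what produces the inhomogeneous term `k f`.
  have hpow : HasDerivAt (fun u : ℝ => (R * ((u : ℂ) + w)) ^ k)
      (k * (R * w) ^ (k - 1) * R) 0 := by
    have h6 := (hlin 0).const_mul (R : ℂ)
    have h7 := (hasDerivAt_zpow k ((R : ℂ) * (((0 : ℝ) : ℂ) + w)) (Or.inl (by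
      simpa using ⟨hR.ne', hw0⟩))).comp (0 : ℝ) h6
    simpa [Function.comp_def] using h7
  have hright := (hpow.const_mul C).mul (hasDerivAt_fourierFun hk hd hα hR hy)
  have hright' := hright.congr_of_eventuallyEq (f₁ := fun u : ℝ =>
    fourierFun k c (-1 / ((R : ℂ) ^ 2 * (u + w)))) (Eventually.of_forall fun u => by
      refine h _ ?_
      rw [hw, ← ofReal_div]; simp; positivity)
  have key := hleft.unique hright'
  simp only [ofReal_zero, zero_add] at key
  rw [← hw] at key
  rw [show (R : ℂ) * w = I * y by rw [hw]; field_simp, zpow_sub_one₀ (mul_ne_zero I_ne_zero hy'),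
    mul_zpow, mul_inv, inv_I] at key
  push_cast at key
  have hne : -I * (R / y : ℂ) ≠ 0 :=
    mul_ne_zero (neg_ne_zero.mpr I_ne_zero) (div_ne_zero hR' hy')
  refine mul_left_cancel₀ hne ?_
  have e : -I * (R / y : ℂ) * derivPart k R c y⁻¹
      = -((y : ℂ) ^ 2)⁻¹ * (I * (R / (y : ℂ)⁻¹) * derivPart k R c y⁻¹) := by field_simp
  rw [e, key]
  ring

lemma hasHeckeContinuation_scaledLambda (hk : k < 0) (hc : c.IsBigO α) (hd : d.IsBigO α)
    (hα : 0 ≤ α) (hR : 0 < R) (hC : C ≠ 0)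
    (h : ∀ z : ℂ, 0 < z.im →
      fourierFun k c (-1 / ((R : ℂ) ^ 2 * z)) = C * (R * z) ^ k * fourierFun k d z) :
    HasHeckeContinuation k (α + 1) (I ^ k * C) (c.plus 0) (c.minus 0 / (R : ℂ) ^ (1 - k))
      (d.plus 0) (d.minus 0 / (R : ℂ) ^ (1 - k)) (scaledLambda k R c) (scaledLambda k R d) := by
  obtain ⟨E, E', h1, h2, h3, h4, h5⟩ := hasHeckeContinuation_mellin
    (rapidDecay_cuspPart hk hc hα hR) (rapidDecay_cuspPart hk hd hα hR) (by linarith) hk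
    (mul_ne_zero (zpow_ne_zero k I_ne_zero) hC) fun y hy => cuspPart_inv hc hd hα hR h hy
  exact ⟨E, E', h1, h2, h3, fun s hs => mellin_cuspPart hk hc hα hR hs ▸ h4 s hs,
    fun s hs => mellin_cuspPart hk hd hα hR hs ▸ h5 s hs⟩

/-- In `-2D + kF` the inhomogeneous term contributes `-2k f`, and with `k f` from the second summand
this leaves `-k f`: the combination is reproduced with the sign reversed. The constant terms do not
depend on `u`, so they enter only through `k` times the function itself. -/
lemma hasHeckeContinuation_scaledOmega (hk : k < 0) (hc : c.IsBigO α) (hd : d.IsBigO α)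
    (hα : 0 ≤ α) (hR : 0 < R) (hC : C ≠ 0)
    (hdiff : ∀ z : ℂ, 0 < z.im → DifferentiableAt ℝ (fourierFun k c) z)
    (h : ∀ z : ℂ, 0 < z.im →
      fourierFun k c (-1 / ((R : ℂ) ^ 2 * z)) = C * (R * z) ^ k * fourierFun k d z) :
    HasHeckeContinuation k (α + 1) (-I ^ k * C) (k * c.plus 0)
      (k * (c.minus 0 / (R : ℂ) ^ (1 - k))) (k * d.plus 0) (k * (d.minus 0 / (R : ℂ) ^ (1 - k)))
      (scaledOmega k R c) (scaledOmega k R d) := by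
  have hr : ∀ {c : FourierCoeffs}, c.IsBigO α →
      RapidDecay (α + 1) (fun y => -2 * derivPart k R c y + k * cuspPart k R c y) := fun hc =>
    ((rapidDecay_derivPart hk hc hα hR).const_mul _).add
      ((rapidDecay_cuspPart hk hc hα hR).const_mul _)
  obtain ⟨E, E', h1, h2, h3, h4, h5⟩ := hasHeckeContinuation_mellin (hr hc) (hr hd)
    (by linarith) hk (ε := -I ^ k * C)
    (mul_ne_zero (neg_ne_zero.mpr (zpow_ne_zero k I_ne_zero)) hC)
    (A := k * c.plus 0) (B := k * (c.minus 0 / (R : ℂ) ^ (1 - k)))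
    (A' := k * d.plus 0) (B' := k * (d.minus 0 / (R : ℂ) ^ (1 - k))) fun y hy => by
      have e1 := cuspPart_inv hc hd hα hR h hy
      have e2 := derivPart_inv hk hc hd hα hR hdiff h hy
      rw [fourierFun_I_mul hd hα hR hy] at e2
      rw [e2]
      linear_combination (k : ℂ) * e1
  exact ⟨E, E', h1, h2, h3, fun s hs => mellin_neg_two_mul_derivPart_add hk hc hα hR hs ▸ h4 s hs,
    fun s hs => mellin_neg_two_mul_derivPart_add hk hd hα hR hs ▸ h5 s hs⟩

end

/-! ### Gauss sums -/

section GaussSums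

lemma isPrimitive_inv {m : ℕ} {ψ : DirichletCharacter ℂ m} (hψ : ψ.IsPrimitive) : ψ⁻¹.IsPrimitive := by
  rw [DirichletCharacter.isPrimitive_def] at hψ ⊢
  rw [DirichletCharacter.conductor_inv, hψ]

variable {m : ℕ} [NeZero m] {ψ : DirichletCharacter ℂ m}

/-- Primitivity makes this valid for every residue, including non-units, where both sides vanish; no
coprimality of the Fourier index to `m` is needed. -/
lemma sum_inv_mul_stdAddChar (hψ : ψ.IsPrimitive) (x : ZMod m) :
    ∑ a : ZMod m, ψ⁻¹ a * ZMod.stdAddChar (x * a)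
      = ψ x * gaussSum ψ⁻¹ (ZMod.stdAddChar (N := m)) := by
  have := gaussSum_mulShift_of_isPrimitive (ZMod.stdAddChar (N := m)) (isPrimitive_inv hψ) x
  rw [inv_inv] at this
  rw [← this, gaussSum]
  simp [AddChar.mulShift_apply]

/-- After expanding the product, orthogonality of additive characters kills every `a` except `a =
-1`. -/
lemma gaussSum_mul_gaussSum_inv (hψ : ψ.IsPrimitive) :
    gaussSum ψ (ZMod.stdAddChar (N := m)) * gaussSum ψ⁻¹ (ZMod.stdAddChar (N := m))
      = ψ (-1) * m := by
  have h1 : gaussSum ψ (ZMod.stdAddChar (N := m)) * gaussSum ψ⁻¹ (ZMod.stdAddChar (N := m))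
      = ∑ a : ZMod m, ψ⁻¹ a * ∑ x : ZMod m, ZMod.stdAddChar (x * (a + 1)) := by
    rw [gaussSum, Finset.sum_mul]
    simp_rw [Finset.mul_sum]
    rw [Finset.sum_comm]
    refine Finset.sum_congr rfl fun x _ => ?_
    rw [mul_right_comm, ← sum_inv_mul_stdAddChar hψ, Finset.sum_mul]
    refine Finset.sum_congr rfl fun a _ => ?_
    rw [mul_add, mul_one, AddChar.map_add_eq_mul, mul_assoc]
  rw [h1, Finset.sum_eq_single (-1)]
  · have : ψ⁻¹ (-1) = ψ (-1) := by
      rw [MulChar.inv_apply]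
      congr 1
      simpa using Ring.inverse_unit (-1 : (ZMod m)ˣ)
    simp [this, ZMod.card]
  · intro a _ ha
    have := AddChar.sum_mulShift (a + 1) (ZMod.isPrimitive_stdAddChar m)
    rw [this, if_neg (by rwa [← eq_neg_iff_add_eq_zero]), Nat.cast_zero, mul_zero]
  · simp

lemma gaussSum_ne_zero (hψ : ψ.IsPrimitive) : gaussSum ψ (ZMod.stdAddChar (N := m)) ≠ 0 := by
  intro h
  have := gaussSum_mul_gaussSum_inv hψ
  rw [h, zero_mul] at this
  have h1 : ψ (-1) ≠ 0 := (isUnit_one.neg.map ψ).ne_zero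
  exact mul_ne_zero h1 (Nat.cast_ne_zero.mpr (NeZero.ne m)) this.symm

lemma CPsi_eq {N : ℕ} (χ : DirichletCharacter ℂ N) (hψ : ψ.IsPrimitive) :
    CPsi χ ψ = χ (m : ZMod N) * ψ (N : ZMod m)
      * gaussSum ψ (ZMod.stdAddChar (N := m)) ^ 2 / (m : ℂ) := by
  have h := gaussSum_mul_gaussSum_inv hψ
  have h1 : ψ (-(N : ZMod m)) = ψ (-1) * ψ (N : ZMod m) := by rw [← map_mul, neg_one_mul]
  rw [CPsi, h1, div_eq_div_iff (gaussSum_ne_zero (isPrimitive_inv hψ))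
    (Nat.cast_ne_zero.mpr (NeZero.ne m))]
  linear_combination (-χ (m : ZMod N) * ψ (N : ZMod m) * gaussSum ψ (ZMod.stdAddChar (N := m))) * h

lemma isUnit_natCast_of_coprime {a b : ℕ} (h : a.Coprime b) : IsUnit (a : ZMod b) :=
  (ZMod.isUnit_iff_coprime a b).mpr h

lemma CPsi_ne_zero {N : ℕ} (χ : DirichletCharacter ℂ N) (hψ : ψ.IsPrimitive) (h : m.Coprime N) :
    CPsi χ ψ ≠ 0 := by
  rw [CPsi_eq χ hψ]
  exact div_ne_zero (mul_ne_zero (mul_ne_zero ((isUnit_natCast_of_coprime h).map χ).ne_zero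
    ((isUnit_natCast_of_coprime h.symm).map ψ).ne_zero) (pow_ne_zero _ (gaussSum_ne_zero hψ)))
    (Nat.cast_ne_zero.mpr (NeZero.ne m))

lemma sum_eq_sum_units {F : ZMod m → ℂ} (hF : ∀ a, ¬ IsUnit a → F a = 0) :
    ∑ a : ZMod m, F a = ∑ u : (ZMod m)ˣ, F u :=
  (Fintype.sum_of_injective (fun u : (ZMod m)ˣ => (u : ZMod m)) Units.val_injective _ _
    (fun a ha => hF a fun h => ha ⟨h.unit, h.unit_spec⟩) fun _ => rfl).symm

end GaussSums

/-! ### Twists -/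

section Twist

lemma FourierCoeffs.IsBigO.twist {c : FourierCoeffs} {α : ℝ} (hc : c.IsBigO α)
    {m : ℕ} (ψ : DirichletCharacter ℂ m) :
    (c.twist ψ).IsBigO α := by
  obtain ⟨C, hC⟩ := hc
  refine ⟨C, fun n hn => ⟨?_, ?_⟩⟩
  · refine le_trans ?_ (hC n hn).1
    rw [FourierCoeffs.twist, norm_mul]
    exact mul_le_of_le_one_left (norm_nonneg _) (DirichletCharacter.norm_le_one ψ _)
  · refine le_trans ?_ (hC n hn).2
    rw [FourierCoeffs.twist, norm_mul]
    exact mul_le_of_le_one_left (norm_nonneg _) (DirichletCharacter.norm_le_one ψ _)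

variable {k : ℤ} {c d : FourierCoeffs} {α : ℝ} {m : ℕ} [NeZero m] {ψ : DirichletCharacter ℂ m}

lemma exp_two_pi_I_mul_add (n : ℤ) (a : ZMod m) (z : ℂ) :
    exp (2 * Real.pi * I * n * (z + (a.val : ℂ) / m))
      = exp (2 * Real.pi * I * n * z) * ZMod.stdAddChar ((n : ZMod m) * a) := by
  have h : ((n : ZMod m) * a) = ((n * (a.val : ℤ) : ℤ) : ZMod m) := by simp
  rw [h, ZMod.stdAddChar_coe, ← Complex.exp_add]
  congr 1
  push_cast
  ring

lemma add_natCast_div_im (z : ℂ) (a m : ℕ) : (z + (a : ℂ) / m).im = z.im := by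
  rw [show (a : ℂ) / m = (((a : ℝ) / m : ℝ) : ℂ) by push_cast; rfl]
  simp

/-- Averaging translates against `ψ̄` multiplies the coefficient of index `n` by `∑ ψ̄(a)
e^{2πina/m} = ψ(n) τ(ψ̄)`. A shift by a real number leaves `v` unchanged, so the non-holomorphic
factors are unaffected. -/
lemma gaussSum_mul_fourierFun_twist (hk : k < 0) (hc : c.IsBigO α) (hα : 0 ≤ α)
    (hψ : ψ.IsPrimitive) {z : ℂ} (hz : 0 < z.im) :
    gaussSum ψ⁻¹ (ZMod.stdAddChar (N := m)) * fourierFun k (c.twist ψ) z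
      = ∑ a : ZMod m, ψ⁻¹ a * fourierFun k c (z + (a.val : ℂ) / m) := by
  have him : ∀ a : ZMod m, (z + (a.val : ℂ) / m).im = z.im := fun a => add_natCast_div_im z _ m
  have hsp : ∀ a : ZMod m, Summable fun n : ℕ => ψ⁻¹ a * (c.plus n * exp (2 * Real.pi * I * (n : ℂ)
      * (z + (a.val : ℂ) / m))) := fun a =>
    (summable_fourier_plus hc hα (by rwa [him])).mul_left _
  have hsm : ∀ a : ZMod m, Summable fun n : ℕ => ψ⁻¹ a * (c.minus (n + 1)
      * ((incGamma (1 - k) (4 * Real.pi * ((n : ℝ) + 1) * z.im) : ℝ) : ℂ)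
      * exp (-(2 * Real.pi * I * ((n : ℂ) + 1) * (z + (a.val : ℂ) / m)))) := fun a => by
    have := summable_fourier_minus hk hc hα (z := z + (a.val : ℂ) / m) (by rwa [him])
    rw [him] at this
    exact this.mul_left _
  have hterm : ∀ a : ZMod m, ψ⁻¹ a * fourierFun k c (z + (a.val : ℂ) / m)
      = (∑' n : ℕ, ψ⁻¹ a * (c.plus n * exp (2 * Real.pi * I * (n : ℂ) * (z + (a.val : ℂ) / m))))
        + ψ⁻¹ a * (c.minus 0 * ((z.im ^ (1 - k) : ℝ) : ℂ))
        + ∑' n : ℕ, ψ⁻¹ a * (c.minus (n + 1)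
          * ((incGamma (1 - k) (4 * Real.pi * ((n : ℝ) + 1) * z.im) : ℝ) : ℂ)
          * exp (-(2 * Real.pi * I * ((n : ℂ) + 1) * (z + (a.val : ℂ) / m)))) := fun a => by
    rw [fourierFun, him, mul_add, mul_add, tsum_mul_left, tsum_mul_left]
  rw [Finset.sum_congr rfl fun a _ => hterm a, Finset.sum_add_distrib, Finset.sum_add_distrib,
    fourierFun, mul_add, mul_add, ← tsum_mul_left, ← tsum_mul_left]
  rw [← Summable.tsum_finsetSum fun a _ => hsp a, ← Summable.tsum_finsetSum fun a _ => hsm a]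
  congr 1
  · congr 1
    · refine tsum_congr fun n => ?_
      have e : ∀ a : ZMod m, ψ⁻¹ a * (c.plus n * exp (2 * Real.pi * I * (n : ℂ)
          * (z + (a.val : ℂ) / m))) = (c.plus n * exp (2 * Real.pi * I * (n : ℂ) * z)) *
            (ψ⁻¹ a * ZMod.stdAddChar ((n : ZMod m) * a)) := by
        intro a
        have := exp_two_pi_I_mul_add (n : ℤ) a z
        push_cast at this
        rw [this]
        ring
      rw [Finset.sum_congr rfl fun a _ => e a, ← Finset.mul_sum, sum_inv_mul_stdAddChar hψ]
      simp only [FourierCoeffs.twist]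
      ring
    · have := sum_inv_mul_stdAddChar hψ 0
      simp only [zero_mul, AddChar.map_zero_eq_one, mul_one] at this
      rw [← Finset.sum_mul, this]
      simp only [FourierCoeffs.twist, Nat.cast_zero, neg_zero]
      ring
  · refine tsum_congr fun n => ?_
    have e : ∀ a : ZMod m, ψ⁻¹ a * (c.minus (n + 1)
        * ((incGamma (1 - k) (4 * Real.pi * ((n : ℝ) + 1) * z.im) : ℝ) : ℂ)
        * exp (-(2 * Real.pi * I * ((n : ℂ) + 1) * (z + (a.val : ℂ) / m)))) = (c.minus (n + 1)
        * ((incGamma (1 - k) (4 * Real.pi * ((n : ℝ) + 1) * z.im) : ℝ) : ℂ)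
        * exp (-(2 * Real.pi * I * ((n : ℂ) + 1) * z))) *
          (ψ⁻¹ a * ZMod.stdAddChar (-((n + 1 : ℕ) : ZMod m) * a)) := by
      intro a
      have := exp_two_pi_I_mul_add (-((n + 1 : ℕ) : ℤ)) a z
      simp only [Int.cast_neg, Int.cast_natCast] at this
      rw [show -(2 * Real.pi * I * ((n : ℂ) + 1) * (z + (a.val : ℂ) / m))
        = 2 * Real.pi * I * -((n + 1 : ℕ) : ℂ) * (z + (a.val : ℂ) / m) by push_cast; ring, this,
        show 2 * Real.pi * I * -((n + 1 : ℕ) : ℂ) * z = -(2 * Real.pi * I * ((n : ℂ) + 1) * z) by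
          push_cast; ring]
      ring
    rw [Finset.sum_congr rfl fun a _ => e a, ← Finset.mul_sum, sum_inv_mul_stdAddChar hψ]
    simp only [FourierCoeffs.twist]
    ring

lemma differentiableAt_fourierFun_twist (hk : k < 0) (hc : c.IsBigO α) (hα : 0 ≤ α)
    (hψ : ψ.IsPrimitive)
    (hdiff : ∀ z : ℂ, 0 < z.im → DifferentiableAt ℝ (fourierFun k c) z) {z : ℂ} (hz : 0 < z.im) :
    DifferentiableAt ℝ (fourierFun k (c.twist ψ)) z := by
  have h1 : DifferentiableAt ℝ (fun z => (gaussSum ψ⁻¹ (ZMod.stdAddChar (N := m)))⁻¹ *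
      ∑ a : ZMod m, ψ⁻¹ a * fourierFun k c (z + (a.val : ℂ) / m)) z := by
    refine (DifferentiableAt.fun_sum fun a _ => DifferentiableAt.const_mul ?_ _).const_mul _
    exact (hdiff _ (by rwa [add_natCast_div_im])).comp z (differentiableAt_id.add_const _)
  refine h1.congr_of_eventuallyEq ?_
  filter_upwards [(isOpen_lt continuous_const Complex.continuous_im).mem_nhds hz] with w hw
  rw [← gaussSum_mul_fourierFun_twist hk hc hα hψ hw,
    inv_mul_cancel_left₀ (gaussSum_ne_zero (isPrimitive_inv hψ))]

end Twist

/-! ### Transformation laws -/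

section Transformation

open UpperHalfPlane hiding I

variable {k : ℤ} {N : ℕ} {χ : DirichletCharacter ℂ N} {f : ℍ → ℂ} {c d : FourierCoeffs} {α : ℝ}

lemma HasFourierSeries.apply_ofComplex (hc : HasFourierSeries k f c) {z : ℂ} (hz : 0 < z.im) :
    f (ofComplex z) = fourierFun k c z := by
  rw [hc, ofComplex_apply_of_im_pos hz]
  rfl

lemma differentiableAt_fourierFun (hc : HasFourierSeries k f c) (hf : IsHarmonicMaassPoly k N χ f)
    {z : ℂ} (hz : 0 < z.im) : DifferentiableAt ℝ (fourierFun k c) z := by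
  have hn : {z : ℂ | 0 < z.im} ∈ 𝓝 z := (isOpen_lt continuous_const Complex.continuous_im).mem_nhds hz
  refine ((hf.smooth.contDiffAt hn).differentiableAt (by simp)).congr_of_eventuallyEq ?_
  filter_upwards [hn] with w hw
  exact (hc.apply_ofComplex hw).symm

lemma neg_one_div_im_pos {r : ℝ} (hr : 0 < r) {z : ℂ} (hz : 0 < z.im) :
    0 < (-1 / ((r : ℂ) * z)).im := by
  have h0 : z ≠ 0 := by rintro rfl; simp at hz
  have : -1 / ((r : ℂ) * z) = ((r⁻¹ : ℝ) : ℂ) * -z⁻¹ := by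
    push_cast
    rw [neg_div, one_div, mul_inv, mul_neg]
  rw [this, im_ofReal_mul, neg_im, inv_im, neg_div, neg_neg]
  have := normSq_pos.mpr h0
  positivity

lemma fourierFun_neg_one_div (hN : 1 ≤ N) (hc : HasFourierSeries k f c)
    (hd : HasFourierSeries k (fricke k N f) d) {z : ℂ} (hz : 0 < z.im) :
    fourierFun k c (-1 / ((N : ℂ) * z)) = (((√(N : ℝ) : ℝ) : ℂ) * z) ^ k * fourierFun k d z := by
  have hNR : (0 : ℝ) < N := by exact_mod_cast hN
  have h0 : z ≠ 0 := by rintro rfl; simp at hz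
  have hN0 : (N : ℂ) ≠ 0 := by exact_mod_cast hNR.ne'
  have him : 0 < (-1 / ((N : ℂ) * z)).im := by simpa using neg_one_div_im_pos hNR hz
  have h := hd.apply_ofComplex hz
  rw [fricke, ofComplex_apply_of_im_pos hz] at h
  rw [hc.apply_ofComplex him] at h
  have hpow : (N : ℝ) ^ ((k : ℝ) / 2) = √(N : ℝ) ^ k := by
    rw [Real.sqrt_eq_rpow, ← Real.rpow_intCast, ← Real.rpow_mul hNR.le]
    congr 1
    ring
  have hsq : (N : ℂ) = ((√(N : ℝ) : ℝ) : ℂ) * ((√(N : ℝ) : ℝ) : ℂ) := by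
    rw [← ofReal_mul, Real.mul_self_sqrt hNR.le]; simp
  rw [← h, hpow, ofReal_zpow]
  have e : (((√(N : ℝ) : ℝ) : ℂ) * z) ^ k * (((√(N : ℝ) : ℝ) : ℂ) ^ k * ((N : ℂ) * z) ^ (-k))
      = 1 := by
    rw [← mul_assoc, ← mul_zpow, mul_right_comm, ← hsq, zpow_neg, mul_inv_cancel₀]
    exact zpow_ne_zero _ (mul_ne_zero hN0 h0)
  rw [← mul_assoc, e, one_mul]

lemma fourierFun_moebius (hc : HasFourierSeries k f c) (hf : IsHarmonicMaassPoly k N χ f)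
    {p q r s : ℤ} (hdet : p * s - q * r = 1) (hr : (N : ℤ) ∣ r) {z : ℂ} (hz : 0 < z.im) :
    fourierFun k c ((p * z + q) / (r * z + s))
      = χ (s : ZMod N) * ((r * z + s) ^ k * fourierFun k c z) := by
  let γ : SL(2, ℤ) := ⟨!![p, q; r, s], by rw [Matrix.det_fin_two_of, hdet]⟩
  let τ : ℍ := ⟨z, hz⟩
  have hγ : γ ∈ CongruenceSubgroup.Gamma0 N := by
    rw [CongruenceSubgroup.Gamma0_mem]
    exact (ZMod.intCast_zmod_eq_zero_iff_dvd _ _).mpr hr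
  have hcoe : ((γ • τ : ℍ) : ℂ) = (p * z + q) / (r * z + s) := by
    rw [coe_specialLinearGroup_apply]
    simp [γ, τ]
  have hden : denom γ τ = r * z + s := by
    rw [ModularGroup.denom_apply]
    rfl
  have h := hf.slash_eq γ hγ τ
  rw [ModularForm.SL_slash_apply, hden] at h
  have h1 : f (γ • τ) = fourierFun k c ((p * z + q) / (r * z + s)) := by
    rw [← hcoe, ← hc.apply_ofComplex (γ • τ).im_pos, ofComplex_apply]
  have h2 : f τ = fourierFun k c z := hc τ
  have hne : (r * z + s : ℂ) ^ k ≠ 0 := zpow_ne_zero _ (hden ▸ denom_ne_zero γ τ)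
  have h3 : (γ 1 1 : ℤ) = s := rfl
  rw [h1, h2, h3, zpow_neg, ← div_eq_mul_inv, div_eq_iff hne] at h
  rw [h]
  ring

/-- With `aNb + 1 = pm`, the matrix with rows `(p, a)` and `(Nb, m)` lies in `Γ₀(N)` and sends `w =
-1/(N(z + b/m))` to `-1/(m²Nz) + a/m`. The automorphy factors `mz/(z + b/m)` and `√N(z + b/m)`
multiply to `m√N z`. -/
lemma fourierFun_neg_one_div_add (hN : 1 ≤ N) (hc : HasFourierSeries k f c)
    (hd : HasFourierSeries k (fricke k N f) d) (hf : IsHarmonicMaassPoly k N χ f)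
    {m : ℕ} [NeZero m] {a b : ℕ} (hab : m ∣ a * N * b + 1) {z : ℂ} (hz : 0 < z.im) :
    fourierFun k c (-1 / (((m * √(N : ℝ) : ℝ) : ℂ) ^ 2 * z) + (a : ℂ) / m)
      = χ (m : ZMod N) * ((((m * √(N : ℝ) : ℝ) : ℂ) * z) ^ k
        * fourierFun k d (z + (b : ℂ) / m)) := by
  obtain ⟨p, hp⟩ := hab
  have hNR : (0 : ℝ) < N := by exact_mod_cast hN
  have hN0 : (N : ℂ) ≠ 0 := by exact_mod_cast hNR.ne'
  have hm0 : (m : ℂ) ≠ 0 := Nat.cast_ne_zero.mpr (NeZero.ne m)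
  have h0 : z ≠ 0 := by rintro rfl; simp at hz
  have hz' : 0 < (z + (b : ℂ) / m).im := by rwa [add_natCast_div_im]
  have h0' : z + (b : ℂ) / m ≠ 0 := by intro h; rw [h] at hz'; simp at hz'
  have h0'' : z * m + b ≠ 0 := by
    intro h; apply h0'; field_simp; simpa using h
  have hw : 0 < (-1 / ((N : ℂ) * (z + (b : ℂ) / m))).im := by
    simpa using neg_one_div_im_pos hNR hz'
  have hsq : ((m * √(N : ℝ) : ℝ) : ℂ) ^ 2 = m ^ 2 * N := by
    rw [← ofReal_pow, mul_pow, Real.sq_sqrt hNR.le]; push_cast; ring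
  have hpC : (a : ℂ) * N * b + 1 = m * p := by exact_mod_cast hp
  have h1 := fourierFun_moebius hc hf (p := p) (q := a) (r := N * b) (s := m)
    (by have : (a : ℤ) * N * b + 1 = m * p := by exact_mod_cast hp
        linear_combination -this) (dvd_mul_right _ _) hw
  have e1 : (((N * b : ℤ) : ℂ) * (-1 / ((N : ℂ) * (z + (b : ℂ) / m))) + ((m : ℤ) : ℂ))
      = m * z / (z + (b : ℂ) / m) := by
    push_cast
    field_simp
    ring
  have e2 : (((p : ℤ) : ℂ) * (-1 / ((N : ℂ) * (z + (b : ℂ) / m))) + ((a : ℤ) : ℂ))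
      / (m * z / (z + (b : ℂ) / m)) = -1 / (((m * √(N : ℝ) : ℝ) : ℂ) ^ 2 * z) + (a : ℂ) / m := by
    rw [hsq]
    push_cast
    field_simp
    linear_combination hpC
  have e3 : m * z / (z + (b : ℂ) / m) * (((√(N : ℝ) : ℝ) : ℂ) * (z + (b : ℂ) / m))
      = ((m * √(N : ℝ) : ℝ) : ℂ) * z := by
    rw [← mul_assoc, mul_right_comm, div_mul_cancel₀ _ h0']
    push_cast
    ring
  rw [e1, e2, fourierFun_neg_one_div hN hc hd hz', ← mul_assoc (_ ^ k), ← mul_zpow, e3] at h1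
  rw [h1, Int.cast_natCast]

lemma fourierFun_twist_neg_one_div (hk : k < 0) (hN : 1 ≤ N) (hc : HasFourierSeries k f c)
    (hd : HasFourierSeries k (fricke k N f) d) (hf : IsHarmonicMaassPoly k N χ f)
    (hcα : c.IsBigO α) (hdα : d.IsBigO α) (hα : 0 ≤ α)
    {m : ℕ} [NeZero m] (hmN : m.Coprime N) {ψ : DirichletCharacter ℂ m} (hψ : ψ.IsPrimitive)
    {z : ℂ} (hz : 0 < z.im) :
    fourierFun k (c.twist ψ) (-1 / (((m * √(N : ℝ) : ℝ) : ℂ) ^ 2 * z))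
      = CPsi χ ψ * (((m * √(N : ℝ) : ℝ) : ℂ) * z) ^ k * fourierFun k (d.twist ψ⁻¹) z := by
  have hNR : (0 : ℝ) < N := by exact_mod_cast hN
  have hm : (0 : ℝ) < m := by exact_mod_cast NeZero.pos m
  have hR : (0 : ℝ) < (m * √(N : ℝ)) ^ 2 := by positivity
  have hw : 0 < (-1 / (((m * √(N : ℝ) : ℝ) : ℂ) ^ 2 * z)).im := by
    rw [← ofReal_pow]; exact neg_one_div_im_pos hR hz
  have hgc := gaussSum_mul_fourierFun_twist hk hcα hα hψ hw
  have hgd := gaussSum_mul_fourierFun_twist hk hdα hα (isPrimitive_inv hψ) hz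
  rw [inv_inv] at hgd
  have hg0 := gaussSum_ne_zero (isPrimitive_inv hψ)
  obtain ⟨n, hn⟩ := isUnit_natCast_of_coprime hmN.symm
  -- Here `Φ(a) = -N⁻¹a⁻¹` is the solution `b` of `aNb = -1`; as a permutation of the units it
  -- reindexes the sum over `a` as a sum over `b`.
  set Φ : (ZMod m)ˣ ≃ (ZMod m)ˣ := (Equiv.inv _).trans (Equiv.mulLeft (-n⁻¹)) with hΦ
  have hrel : ∀ u : (ZMod m)ˣ, (u : ZMod m) * N * (Φ u : (ZMod m)ˣ) = -1 := by
    intro u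
    rw [← hn, ← Units.val_mul, ← Units.val_mul, ← Units.val_one, ← Units.val_neg]
    congr 1
    simp only [hΦ, Equiv.trans_apply, Equiv.inv_apply, Equiv.coe_mulLeft, neg_mul, mul_neg]
    congr 1
    group
  have hdvd : ∀ u : (ZMod m)ˣ, m ∣ (u : ZMod m).val * N * ((Φ u : (ZMod m)ˣ) : ZMod m).val + 1 := by
    intro u
    rw [← ZMod.natCast_eq_zero_iff]
    push_cast
    rw [ZMod.natCast_zmod_val, ZMod.natCast_zmod_val, hrel, neg_add_cancel]
  have hψu : ∀ u : (ZMod m)ˣ, ψ⁻¹ u = ψ (-(N : ZMod m)) * ψ (Φ u : (ZMod m)ˣ) := by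
    intro u
    rw [MulChar.inv_apply, Ring.inverse_unit, ← map_mul]
    congr 1
    rw [Units.inv_eq_of_mul_eq_one_right]
    linear_combination -hrel u
  have hsum : ∑ a : ZMod m, ψ⁻¹ a * fourierFun k c (-1 / (((m * √(N : ℝ) : ℝ) : ℂ) ^ 2 * z)
      + (a.val : ℂ) / m) = χ (m : ZMod N) * (((m * √(N : ℝ) : ℝ) : ℂ) * z) ^ k
        * ψ (-(N : ZMod m)) * ∑ b : ZMod m, ψ b * fourierFun k d (z + (b.val : ℂ) / m) := by
    rw [sum_eq_sum_units fun a ha => by rw [MulChar.map_nonunit _ ha, zero_mul],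
      sum_eq_sum_units fun a ha => by rw [MulChar.map_nonunit _ ha, zero_mul], Finset.mul_sum]
    refine Fintype.sum_equiv Φ _ _ fun u => ?_
    rw [fourierFun_neg_one_div_add hN hc hd hf (hdvd u) hz, hψu]
    ring
  refine mul_left_cancel₀ hg0 ?_
  rw [hgc, hsum, ← hgd, CPsi]
  field_simp

end Transformation

/-! ### The direct theorem -/

section

variable {k : ℤ} {σ : ℝ} {ε A B A' B' : ℂ} {D D' : ℂ → ℂ}

/-- The reflection `s ↦ k - s` exchanges `0` with `k` and `k - 1` with `1`. The identity also holds
at the poles, where division by zero gives `0` for matching terms. -/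
lemma polarPart_functional_equation (hε : ε ≠ 0) (s : ℂ) :
    polarPart k ε A B A' B' s = ε * polarPart k ε⁻¹ A' B' A B (k - s) := by
  rw [polarPart, polarPart, sub_sub_cancel, show (k : ℂ) - s - k + 1 = 1 - s by ring,
    show 1 - ((k : ℂ) - s) = s - k + 1 by ring]
  have h : ε * ε⁻¹ = 1 := mul_inv_cancel₀ hε
  linear_combination (-(A / s) - B * (1 / (s - k + 1))) * h

lemma meromorphicOn_sub_polarPart {E : ℂ → ℂ} (hE : Differentiable ℂ E) :
    MeromorphicOn (fun s => E s - polarPart k ε A B A' B' s) univ := by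
  intro s _
  have h1 : MeromorphicAt E s := (hE.analyticAt s).meromorphicAt
  unfold polarPart
  fun_prop

lemma HasHeckeContinuation.exists_meromorphic (h : HasHeckeContinuation k σ ε A B A' B' D D')
    (hε : ε ≠ 0) :
    ∃ F G : ℂ → ℂ, (MeromorphicOn F univ ∧ Extends σ D F) ∧ (MeromorphicOn G univ ∧ Extends σ D' G) ∧
      (∀ s, F s = ε * G (k - s)) ∧
      (∃ E, Differentiable ℂ E ∧ BoundedInVerticalStrips E ∧
        ∀ s, E s = F s + polarPart k ε A B A' B' s) ∧
      (∃ E, Differentiable ℂ E ∧ BoundedInVerticalStrips E ∧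
        ∀ s, E s = G s + polarPart k ε⁻¹ A' B' A B s) := by
  obtain ⟨E, E', ⟨h1, h2⟩, ⟨h3, h4⟩, h5, h6, h7⟩ := h
  refine ⟨fun s => E s - polarPart k ε A B A' B' s, fun s => E' s - polarPart k ε⁻¹ A' B' A B s,
    ⟨meromorphicOn_sub_polarPart h1, fun s hs => (h6 s hs).symm⟩,
    ⟨meromorphicOn_sub_polarPart h3, fun s hs => (h7 s hs).symm⟩, fun s => ?_,
    ⟨E, h1, h2, fun s => (sub_add_cancel _ _).symm⟩, ⟨E', h3, h4, fun s => (sub_add_cancel _ _).symm⟩⟩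
  simp only
  rw [h5, polarPart_functional_equation hε, mul_sub]

lemma HasHeckeContinuation.exists_entire (h : HasHeckeContinuation k σ ε 0 0 0 0 D D') :
    ∃ F G : ℂ → ℂ, IsEntireContinuation σ D F ∧ IsEntireContinuation σ D' G ∧
      ∀ s, F s = ε * G (k - s) := by
  obtain ⟨E, E', ⟨h1, h2⟩, ⟨h3, h4⟩, h5, h6, h7⟩ := h
  refine ⟨E, E', ⟨h1, h2, fun s hs => ?_⟩, ⟨h3, h4, fun s hs => ?_⟩, h5⟩
  · rw [h6 s hs]; simp [polarPart]
  · rw [h7 s hs]; simp [polarPart]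

end

/-! ### Application to `f` and its Fricke transform. -/

section

variable {k : ℤ} {N : ℕ} {χ : DirichletCharacter ℂ N} {f : UpperHalfPlane → ℂ}
  {c d : FourierCoeffs} {α : ℝ}

lemma twistedFunctionalEquations (hk : k < 0) (hN : 1 ≤ N) (hc : HasFourierSeries k f c)
    (hd : HasFourierSeries k (fricke k N f) d) (hf : IsHarmonicMaassPoly k N χ f)
    (hcα : c.IsBigO α) (hdα : d.IsBigO α) (hα : 0 ≤ α)
    {m : ℕ} [NeZero m] (hm : 1 < m) (hmN : m.Coprime N) {ψ : DirichletCharacter ℂ m}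
    (hψ : ψ.IsPrimitive) : TwistedFunctionalEquations k N χ (α + 1) c d ψ := by
  have hNR : (0 : ℝ) < N := by exact_mod_cast hN
  have hmR : (0 : ℝ) < m := by exact_mod_cast NeZero.pos m
  have hR : 0 < (m : ℝ) * √(N : ℝ) := by positivity
  -- For `m > 1` the residue `0` is not a unit, so twisting kills both constant terms and with them
  -- the whole polar part.
  have h0 : ∀ φ : DirichletCharacter ℂ m, φ 0 = 0 := fun φ => by
    have : Fact (1 < m) := ⟨hm⟩
    exact MulChar.map_nonunit φ not_isUnit_zero
  have hp : ∀ (c : FourierCoeffs) (φ : DirichletCharacter ℂ m), (c.twist φ).plus 0 = 0 :=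
    fun c φ => by simp [FourierCoeffs.twist, h0]
  have hm : ∀ (c : FourierCoeffs) (φ : DirichletCharacter ℂ m), (c.twist φ).minus 0 = 0 :=
    fun c φ => by simp [FourierCoeffs.twist, h0]
  have hC := CPsi_ne_zero χ hψ hmN
  have ht : ∀ z : ℂ, 0 < z.im → _ := fun z hz =>
    fourierFun_twist_neg_one_div hk hN hc hd hf hcα hdα hα hmN hψ hz
  have hΛ := hasHeckeContinuation_scaledLambda hk (hcα.twist ψ) (hdα.twist ψ⁻¹) hα hR hC ht
  have hΩ := hasHeckeContinuation_scaledOmega hk (hcα.twist ψ) (hdα.twist ψ⁻¹) hα hR hC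
    (fun z hz => differentiableAt_fourierFun_twist hk hcα hα hψ
      (fun z hz => differentiableAt_fourierFun hc hf hz) hz) ht
  simp only [hp, hm, zero_div, mul_zero] at hΛ hΩ
  obtain ⟨Λf, Λg, a1, a2, a3⟩ := hΛ.exists_entire
  obtain ⟨Ωf, Ωg, b1, b2, b3⟩ := hΩ.exists_entire
  exact ⟨Λf, Λg, Ωf, Ωg, a1, a2, b1, b2, a3, b3⟩

lemma untwistedCondition (hk : k < 0) (hN : 1 ≤ N) (hc : HasFourierSeries k f c)
    (hd : HasFourierSeries k (fricke k N f) d) (hf : IsHarmonicMaassPoly k N χ f)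
    (hcα : c.IsBigO α) (hdα : d.IsBigO α) (hα : 0 ≤ α) :
    UntwistedCondition k N (α + 1) c d := by
  have hNR : (0 : ℝ) < N := by exact_mod_cast hN
  have hR : 0 < √(N : ℝ) := by positivity
  -- The untwisted case is `R = √N` and `C = 1`.
  have ht : ∀ z : ℂ, 0 < z.im → fourierFun k c (-1 / (((√(N : ℝ) : ℝ) : ℂ) ^ 2 * z))
      = 1 * (((√(N : ℝ) : ℝ) : ℂ) * z) ^ k * fourierFun k d z := fun z hz => by
    rw [← ofReal_pow, Real.sq_sqrt hNR.le, one_mul, ofReal_natCast]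
    exact fourierFun_neg_one_div hN hc hd hz
  have hΛ := hasHeckeContinuation_scaledLambda hk hcα hdα hα hR one_ne_zero ht
  have hΩ := hasHeckeContinuation_scaledOmega hk hcα hdα hα hR one_ne_zero
    (fun z hz => differentiableAt_fourierFun hc hf hz) ht
  have hr : (((√(N : ℝ) : ℝ) : ℂ)) ^ (1 - k) = (((N : ℝ) ^ ((1 - (k : ℝ)) / 2) : ℝ) : ℂ) := by
    rw [← ofReal_zpow, Real.sqrt_eq_rpow, ← Real.rpow_intCast, ← Real.rpow_mul hNR.le]
    congr 2
    push_cast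
    ring
  have hI : (I : ℂ) ^ k ≠ 0 := zpow_ne_zero k I_ne_zero
  have hI' : -(I : ℂ) ^ k ≠ 0 := neg_ne_zero.mpr hI
  rw [hr, mul_one] at hΛ hΩ
  obtain ⟨Λf, Λg, a1, a2, a3, ⟨E1, e1, e1', e1''⟩, ⟨E2, e2, e2', e2''⟩⟩ := hΛ.exists_meromorphic hI
  obtain ⟨Ωf, Ωg, b1, b2, b3, ⟨E3, e3, e3', e3''⟩, ⟨E4, e4, e4', e4''⟩⟩ := hΩ.exists_meromorphic hI'
  refine ⟨Λf, Λg, Ωf, Ωg, a1, a2, b1, b2, fun s _ => a3 s, fun s _ => b3 s,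
    ⟨E1, e1, e1', fun s _ => ?_⟩, ⟨E2, e2, e2', fun s _ => ?_⟩, ⟨E3, e3, e3', fun s _ => ?_⟩,
    ⟨E4, e4, e4', fun s _ => ?_⟩⟩
  · rw [e1'', polarPart]; ring
  · rw [e2'', polarPart, zpow_neg]; ring
  · rw [e3'', polarPart]; ring
  · rw [e4'', polarPart, zpow_neg, inv_neg]; ring

lemma twistedCondition (hk : k < 0) (hN : 1 ≤ N) (hc : HasFourierSeries k f c)
    (hd : HasFourierSeries k (fricke k N f) d) (hf : IsHarmonicMaassPoly k N χ f)
    (hcα : c.IsBigO α) (hdα : d.IsBigO α) (hα : 0 ≤ α) {P : Set ℕ} (hP : IsAdmissibleModuli N P) :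
    TwistedCondition k N χ (α + 1) c d P := by
  intro m _ hmP ψ hψ
  obtain ⟨hm, hmN⟩ := hP.1 m hmP
  have h1 : 1 < m := by
    rcases hm with ⟨h, _⟩ | rfl
    · exact h.one_lt
    · norm_num
  -- The theorem for `ψ̄` controls the series of `g` twisted by the conjugate of `ψ̄`, that is, by
  -- `ψ` itself.
  obtain ⟨_, Λg, _, Ωg, _, hΛ, _, hΩ, _⟩ := twistedFunctionalEquations hk hN hc hd hf hcα hdα hα h1
    hmN (isPrimitive_inv hψ)
  rw [inv_inv] at hΛ hΩ
  exact ⟨twistedFunctionalEquations hk hN hc hd hf hcα hdα hα h1 hmN hψ, ⟨Λg, hΛ⟩, ⟨Ωg, hΩ⟩⟩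

end

end HarmonicMaass

end

theorem mainTheorem5 (k : ℤ) (hk : k < 0) (N : ℕ) (hN : 1 ≤ N)
    (χ : DirichletCharacter ℂ N) (hχ : χ (-1) = (-1 : ℂ) ^ k)
    (f g : UpperHalfPlane → ℂ) (c d : HarmonicMaass.FourierCoeffs) (α : ℝ) (hα : 0 ≤ α)
    (hc : HarmonicMaass.HasFourierSeries k f c) (hd : HarmonicMaass.HasFourierSeries k g d)
    (hcα : c.IsBigO α) (hdα : d.IsBigO α)
    (hf : HarmonicMaass.IsHarmonicMaassPoly k N χ f)
    (hg : g = HarmonicMaass.fricke k N f) :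
    -- the twisted series, for every primitive character of conductor `m > 1` coprime to `N`
    (∀ (m : ℕ) [NeZero m], 1 < m → m.Coprime N →
      ∀ ψ : DirichletCharacter ℂ m, ψ.IsPrimitive →
        HarmonicMaass.TwistedFunctionalEquations k N χ (α + 1) c d ψ ∧
        HarmonicMaass.CPsi χ ψ =
          χ (m : ZMod N) * ψ (N : ZMod m) * gaussSum ψ (ZMod.stdAddChar (N := m)) ^ 2 / (m : ℂ)) ∧
    -- the direct part of the converse theorem
    HarmonicMaass.UntwistedCondition k N (α + 1) c d ∧
    (∀ P : Set ℕ, HarmonicMaass.IsAdmissibleModuli N P →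
      HarmonicMaass.TwistedCondition k N χ (α + 1) c d P) := by
  subst hg
  exact ⟨fun m _ hm hmN ψ hψ => ⟨HarmonicMaass.twistedFunctionalEquations hk hN hc hd hf hcα hdα hα
    hm hmN hψ, HarmonicMaass.CPsi_eq χ hψ⟩,
    HarmonicMaass.untwistedCondition hk hN hc hd hf hcα hdα hα,
    fun P hP => HarmonicMaass.twistedCondition hk hN hc hd hf hcα hdα hα hP⟩
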